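/- Let $\chi$ be a primitive Dirichlet character of conductor $q$ and write $\chi=\prod_{p\mid q}\chi^{(p)}$, where $\chi^{(p)}$ is a Dirichlet character modulo (and of conductor) the exact power of the prime $p$ dividing $q$. Call $\chi$ totally sextic if $\chi$ has order $6$ and every component $\chi^{(p)}$ with $p\mid q$ has exact order $6$. For real $X$ let $\Psi_6^{\mathrm{tot}}(X)$ be the set of totally sextic primitive Dirichlet characters of conductor at most $X$, and let $\Psi_6'(X)$ be the set of primitive Dirichlet characters of order $6$ whose conductor is prime and at most $X$. Then there is a constant $K_6^{\mathrm{tot}}>0$ such that, as $X\to\infty$, $$|\Psi_6^{\mathrm{tot}}(X)|\sim K_6^{\mathrm{tot}}\,X \qquad\text{and}\qquad |\Psi_6'(X)|\sim \frac{X}{\log X}.$$ -/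

import Mathlib

open Filter Asymptotics

namespace SexticCount

/-- For `q ≥ 1` and a prime `p ∣ q`, the inclusion of the factor `(ℤ/p^{v_p(q)})ˣ` in `(ℤ/q)ˣ`
given by the Chinese remainder theorem: `a` goes to the class that is `a` modulo `p^{v_p(q)}` and
`1` modulo the other prime powers exactly dividing `q`. -/
noncomputable def localInclusion (q : ℕ) [NeZero q] (p : q.primeFactors) :
    (ZMod ((p : ℕ) ^ q.factorization p))ˣ →* (ZMod q)ˣ :=
  ((Units.mapEquiv (ZMod.equivPi q (NeZero.ne q)).toMulEquiv).trans
      MulEquiv.piUnits).symm.toMonoidHom.comp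
    (MonoidHom.mulSingle
      (fun p : q.primeFactors => (ZMod ((p : ℕ) ^ q.factorization p))ˣ) p)

/-- The `p`-component `χ^{(p)}`, a character modulo `p^{v_p(q)}`, of a Dirichlet character `χ`
modulo `q`. -/
noncomputable def localComponent {q : ℕ} [NeZero q] (χ : DirichletCharacter ℂ q)
    (p : q.primeFactors) : DirichletCharacter ℂ ((p : ℕ) ^ q.factorization p) :=
  MulChar.ofUnitHom (χ.toUnitHom.comp (localInclusion q p))

/-- A Dirichlet character modulo `q` is the product of its local components. -/
theorem eq_prod_localComponent {q : ℕ} [NeZero q] (χ : DirichletCharacter ℂ q) :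
    χ = ∏ p : q.primeFactors,
      DirichletCharacter.changeLevel (Nat.ordProj_dvd q p) (localComponent χ p) := by
  have key : ∀ u : (ZMod q)ˣ, ∏ p : q.primeFactors, localInclusion q p
      (ZMod.unitsMap (Nat.ordProj_dvd q p) u) = u := by
    intro u
    set e := (Units.mapEquiv (ZMod.equivPi q (NeZero.ne q)).toMulEquiv).trans
      MulEquiv.piUnits with he
    have h : ∀ p : q.primeFactors, localInclusion q p (ZMod.unitsMap (Nat.ordProj_dvd q p) u) =
        e.symm (Pi.mulSingle p (e u p)) := by
      intro p
      have h' : ZMod.unitsMap (Nat.ordProj_dvd q p) u = e u p := by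
        ext
        exact RingHom.congr_fun (Subsingleton.elim
          (ZMod.castHom (Nat.ordProj_dvd q p) (ZMod ((p : ℕ) ^ q.factorization p)))
          ((Pi.evalRingHom (fun p : q.primeFactors => ZMod ((p : ℕ) ^ q.factorization p)) p).comp
            (ZMod.equivPi q (NeZero.ne q)).toRingHom)) (u : ZMod q)
      rw [h']
      rfl
    rw [Finset.prod_congr rfl fun p _ => h p, ← map_prod, Finset.univ_prod_mulSingle,
      MulEquiv.symm_apply_apply]
  apply MulChar.ext
  intro u
  rw [← MulChar.coe_toUnitHom, ← MulChar.coe_toUnitHom]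
  congr 1
  conv_lhs => rw [← key u, map_prod]
  have h2 : ∀ (s : Finset q.primeFactors) (f : q.primeFactors → DirichletCharacter ℂ q),
      (∏ p ∈ s, f p).toUnitHom = ∏ p ∈ s, (f p).toUnitHom := fun s f =>
    map_prod MulChar.mulEquivToUnitHom f s
  rw [h2, MonoidHom.finsetProd_apply]
  refine Finset.prod_congr rfl fun p _ => ?_
  rw [DirichletCharacter.changeLevel_toUnitHom]
  simp only [localComponent, MonoidHom.comp_apply]
  ext
  simp

/-- `χ` is totally of order `l`: it has order `l` and so does each of its local components at the
primes dividing its modulus. By convention the trivial character is totally of every order. (Meant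
for primitive `χ`, whose modulus is its conductor.) -/
def IsTotallyOrder (l : ℕ) {q : ℕ} [NeZero q] (χ : DirichletCharacter ℂ q) : Prop :=
  χ = 1 ∨ (orderOf χ = l ∧ ∀ p : q.primeFactors, orderOf (localComponent χ p) = l)

/-- The set of primitive Dirichlet characters of order `l`, of arbitrary modulus. -/
def primitiveChars (l : ℕ) : Set (Σ q : ℕ+, DirichletCharacter ℂ (q : ℕ)) :=
  {χ | χ.2.IsPrimitive ∧ orderOf χ.2 = l}

/-- The primitive characters of order `l` that are totally of order `l`. -/
def totalChars (l : ℕ) : Set (Σ q : ℕ+, DirichletCharacter ℂ (q : ℕ)) :=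
  {χ | χ ∈ primitiveChars l ∧ IsTotallyOrder l χ.2}

/-- The primitive characters of order `l` and prime conductor. -/
def primeConductorChars (l : ℕ) : Set (Σ q : ℕ+, DirichletCharacter ℂ (q : ℕ)) :=
  {χ | χ ∈ primitiveChars l ∧ χ.2.conductor.Prime}

/-- The number of characters of conductor at most `X` in the family `F`. -/
noncomputable def countUpTo (F : Set (Σ q : ℕ+, DirichletCharacter ℂ (q : ℕ))) (X : ℝ) : ℕ :=
  {χ | χ ∈ F ∧ (χ.2.conductor : ℝ) ≤ X}.ncard

end SexticCount

/-! A character modulo `q` is the free product of its components at the primes dividing `q`, and it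
is primitive exactly when every component is (`isPrimitive_iff_localComponent`). Totally sextic
characters are therefore counted by a multiplicative function. A primitive character of order 6
modulo `p ^ v` exists only for `p ≡ 1 (mod 3)`, `v = 1`, or for `p ^ v = 9`, and there are then two
(`card_isPrimitive_orderOf_prime_pow`).

The counting series is thus `(1 + 2 · 9^{-s}) ∏_{p ≡ 1 (3)} (1 + 2 p^{-s}) = ζ(s) L(s, χ₃) H(s)`.
The Euler factors of `H` at `s = 1` are positive and `1 + O(p^{-2})`, so `H(1)` converges absolutely
and is positive. The partial sums of `1 * χ₃` up to `N` are `L(1, χ₃) N + o(N)` by pairing the terms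
of an alternating series, and convolving with the coefficients of `H` keeps a linear main term with
constant `L(1, χ₃) H(1)`. No complex analysis is needed here.

For prime conductor there are two characters for each prime `p ≡ 1 (mod 6)`, so the prime number
theorem modulo 6 gives `2 · X / (φ(6) log X)`. That theorem comes from the Wiener–Ikehara theorem
(`tendsto_sum_div_of_LSeries`), proved by smoothing with the Fejér kernel, the Riemann–Lebesgue
lemma and a monotonicity argument that removes the smoothing. -/

open MeasureTheory Topology

/-! ### The Fejér kernel -/

namespace SexticCount

/-- The Fejér kernel, normalised as the Fourier transform of `y ↦ max (1 - |y|) 0`. -/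
noncomputable def fejer (u : ℝ) : ℝ := 2 * (1 - Real.cos u) / u ^ 2

theorem fejer_nonneg (u : ℝ) : 0 ≤ fejer u := by
  unfold fejer
  have := Real.cos_le_one u
  positivity [sub_nonneg.2 this]

theorem measurable_fejer : Measurable fejer := by
  unfold fejer
  fun_prop

theorem fejer_le (u : ℝ) : fejer u ≤ 5 * (1 + u ^ 2)⁻¹ := by
  unfold fejer
  rcases eq_or_ne u 0 with rfl | hu
  · norm_num
  have h1 : 0 < u ^ 2 := by positivity
  rw [← div_eq_mul_inv, div_le_div_iff₀ h1 (by positivity)]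
  -- The constant is `5 = 1 + 4`: `2 (1 - cos u)` is at most `u ^ 2`, and also at most `4`, which
  -- serves for the part multiplied by `u ^ 2`.
  have h2 := Real.one_sub_sq_div_two_le_cos (x := u)
  have h3 := Real.neg_one_le_cos u
  nlinarith

theorem integrable_fejer : Integrable fejer :=
  (integrable_inv_one_add_sq.const_mul 5).mono' measurable_fejer.aestronglyMeasurable
    (ae_of_all _ fun u => by
      rw [Real.norm_of_nonneg (fejer_nonneg u)]
      exact fejer_le u)

theorem integral_fejer_pos : 0 < ∫ u, fejer u := by
  rw [integral_pos_iff_support_of_nonneg fejer_nonneg integrable_fejer]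
  refine lt_of_lt_of_le (b := volume (Set.Ioo (0 : ℝ) Real.pi)) ?_ (measure_mono fun u hu => ?_)
  · simp [Real.pi_pos]
  · have h : Real.cos u < 1 := by
      have := Real.cos_lt_cos_of_nonneg_of_le_pi le_rfl hu.2.le hu.1
      simpa using this
    have := sub_pos.2 h
    have := hu.1
    rw [Function.mem_support]
    unfold fejer
    positivity

/-- The triangle function whose Fourier transform is the Fejér kernel. -/
theorem integral_triangle_mul_exp {u : ℝ} (hu : u ≠ 0) :
    ∫ y in (-1 : ℝ)..1, ((1 - |y| : ℝ) : ℂ) * Complex.exp (Complex.I * (u * y)) = fejer u := by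
  set c : ℂ := Complex.I * u with hc
  have hc0 : c ≠ 0 := by simp [hc, hu]
  have hexp : ∀ y : ℝ, HasDerivAt (fun y : ℝ => Complex.exp (c * y)) (Complex.exp (c * y) * c) y := by
    intro y
    have := ((hasDerivAt_id (y : ℂ)).const_mul c).cexp.comp_ofReal
    simpa using this
  have hrew : ∀ y : ℝ, Complex.I * (u * y) = c * y := fun y => by rw [hc]; ring
  simp_rw [hrew]
  have hcont : Continuous fun y : ℝ => ((1 - |y| : ℝ) : ℂ) * Complex.exp (c * y) := by fun_prop
  rw [← intervalIntegral.integral_add_adjacent_intervals (b := 0)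
    (hcont.intervalIntegrable _ _) (hcont.intervalIntegrable _ _)]
  have h1 : ∫ y in (-1 : ℝ)..0, ((1 - |y| : ℝ) : ℂ) * Complex.exp (c * y) =
      1 / c - 1 / c ^ 2 + Complex.exp (-c) / c ^ 2 := by
    have := intervalIntegral.integral_eq_sub_of_hasDerivAt (a := -1) (b := 0)
      (f := fun y : ℝ => (1 + (y : ℂ)) * (Complex.exp (c * y) / c) - Complex.exp (c * y) / c ^ 2)
      (f' := fun y : ℝ => ((1 + y : ℝ) : ℂ) * Complex.exp (c * y)) (fun y _ => by
        have := ((((hasDerivAt_id (y : ℝ)).ofReal_comp).const_add (1 : ℂ)).mul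
          ((hexp y).div_const c)).sub ((hexp y).div_const (c ^ 2))
        refine this.congr_deriv ?_
        push_cast
        simp only [id]
        field_simp
        ring) (Continuous.intervalIntegrable (by fun_prop) _ _)
    rw [intervalIntegral.integral_congr (g := fun y : ℝ => ((1 + y : ℝ) : ℂ) * Complex.exp (c * y)),
      this]
    · simp
    · intro y hy
      rw [Set.uIcc_of_le (by norm_num)] at hy
      simp only [abs_of_nonpos hy.2, sub_neg_eq_add]
  have h2 : ∫ y in (0 : ℝ)..1, ((1 - |y| : ℝ) : ℂ) * Complex.exp (c * y) =
      Complex.exp c / c ^ 2 - 1 / c - 1 / c ^ 2 := by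
    have := intervalIntegral.integral_eq_sub_of_hasDerivAt (a := 0) (b := 1)
      (f := fun y : ℝ => (1 - (y : ℂ)) * (Complex.exp (c * y) / c) + Complex.exp (c * y) / c ^ 2)
      (f' := fun y : ℝ => ((1 - y : ℝ) : ℂ) * Complex.exp (c * y)) (fun y _ => by
        have := ((((hasDerivAt_id (y : ℝ)).ofReal_comp).const_sub (1 : ℂ)).mul
          ((hexp y).div_const c)).add ((hexp y).div_const (c ^ 2))
        refine this.congr_deriv ?_
        push_cast
        simp only [id]
        field_simp
        ring) (Continuous.intervalIntegrable (by fun_prop) _ _)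
    rw [intervalIntegral.integral_congr (g := fun y : ℝ => ((1 - y : ℝ) : ℂ) * Complex.exp (c * y)),
      this]
    · simp
      ring
    · intro y hy
      rw [Set.uIcc_of_le (by norm_num)] at hy
      simp only [abs_of_nonneg hy.1]
  rw [h1, h2, fejer]
  have hcos : Complex.exp c + Complex.exp (-c) = 2 * Complex.cos u := by
    rw [Complex.two_cos, hc]
    congr 2 <;> ring
  have hc2 : c ^ 2 = -(u : ℂ) ^ 2 := by rw [hc, mul_pow, Complex.I_sq]; ring
  have hu' : (u : ℂ) ≠ 0 := by exact_mod_cast hu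
  push_cast
  calc _ = (Complex.exp c + Complex.exp (-c) - 2) / c ^ 2 := by ring
    _ = _ := by
      rw [hcos, hc2]
      field_simp
      ring

theorem norm_triangle_le {y : ℝ} (hy : y ∈ Set.Ioc (-1 : ℝ) 1) : ‖((1 - |y| : ℝ) : ℂ)‖ ≤ 1 := by
  have h : |y| ≤ 1 := abs_le.2 ⟨hy.1.le, hy.2⟩
  rw [Complex.norm_real, Real.norm_of_nonneg (by linarith)]
  linarith [abs_nonneg y]

/-! ### Laplace transforms and Fejér means -/

section Laplace

variable {D : ℝ → ℝ} {B : ℝ} {g : ℂ → ℂ}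

/-- Fubini: integrating the triangle against the Laplace kernel first produces the Fejér kernel
centred at `x`. Positivity of `σ` supplies the integrable majorant `B exp (-σ t)`. -/
theorem integral_triangle_mul_laplace (hD : Measurable D) (hB : ∀ t, |D t| ≤ B)
    (hg : ∀ z : ℂ, 0 < z.re → ∫ t in Set.Ioi (0 : ℝ), (D t : ℂ) * Complex.exp (-z * t) = g z)
    {l : ℝ} (hl : 0 < l) (x : ℝ) {σ : ℝ} (hσ : 0 < σ) :
    ∫ y in (-1 : ℝ)..1, ((1 - |y| : ℝ) : ℂ) * g (σ + Complex.I * (l * y)) *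
        Complex.exp (Complex.I * (l * x * y)) =
      ∫ t in Set.Ioi (0 : ℝ), ((D t * Real.exp (-σ * t) * fejer (l * (x - t)) : ℝ) : ℂ) := by
  have hDm : Measurable fun t => (D t : ℂ) := by fun_prop
  rw [intervalIntegral.integral_of_le (by norm_num)]
  calc _ = ∫ y in Set.Ioc (-1 : ℝ) 1, ∫ t in Set.Ioi (0 : ℝ), ((1 - |y| : ℝ) : ℂ) *
        Complex.exp (Complex.I * (l * x * y)) *
          ((D t : ℂ) * Complex.exp (-(σ + Complex.I * (l * y)) * t)) := by
        refine integral_congr_ae (ae_of_all _ fun y => ?_)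
        simp only
        rw [integral_const_mul, hg _ (by simpa using hσ)]
        ring
    _ = ∫ t in Set.Ioi (0 : ℝ), ∫ y in Set.Ioc (-1 : ℝ) 1, ((1 - |y| : ℝ) : ℂ) *
        Complex.exp (Complex.I * (l * x * y)) *
          ((D t : ℂ) * Complex.exp (-(σ + Complex.I * (l * y)) * t)) := by
        refine integral_integral_swap ?_
        have h1 : Integrable (fun _ : ℝ => (1 : ℝ)) (volume.restrict (Set.Ioc (-1 : ℝ) 1)) := by
          simp
        have h2 : Integrable (fun t : ℝ => B * Real.exp (-σ * t))
            (volume.restrict (Set.Ioi (0 : ℝ))) :=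
          (integrableOn_exp_mul_Ioi (neg_lt_zero.2 hσ) 0).const_mul B
        refine (h1.mul_prod h2).mono' ?_ ?_
        · refine Measurable.aestronglyMeasurable ?_
          have h3 : Measurable fun p : ℝ × ℝ => (D p.2 : ℂ) := hDm.comp measurable_snd
          have h4 : Measurable fun p : ℝ × ℝ => ((1 - |p.1| : ℝ) : ℂ) *
              Complex.exp (Complex.I * (l * x * p.1)) := by fun_prop
          have h5 : Measurable fun p : ℝ × ℝ =>
              Complex.exp (-(σ + Complex.I * (l * p.1)) * p.2) := by fun_prop
          exact h4.mul (h3.mul h5)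
        · rw [Measure.prod_restrict]
          refine (ae_restrict_mem (measurableSet_Ioc.prod measurableSet_Ioi)).mono ?_
          rintro ⟨y, t⟩ ⟨hy, ht⟩
          simp only [Function.uncurry_apply_pair, one_mul, norm_mul, Complex.norm_exp]
          have e1 : (Complex.I * (l * x * y)).re = 0 := by simp
          have e2 : (-(σ + Complex.I * (l * y)) * t : ℂ).re = -σ * t := by simp
          rw [e1, e2, Real.exp_zero, mul_one, Complex.norm_real (D t), Real.norm_eq_abs (D t)]
          have h6 := norm_triangle_le hy
          have h7 := hB t
          have h8 := (Real.exp_pos (-σ * t)).le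
          calc _ ≤ 1 * (|D t| * Real.exp (-σ * t)) := by gcongr
            _ ≤ _ := by rw [one_mul]; gcongr
    _ = _ := by
        refine integral_congr_ae ?_
        -- The point `t = x` must be discarded: `fejer 0` is `0` by the convention for division by
        -- zero, whereas the triangle has integral `1`.
        have hne : ∀ᵐ t ∂(volume.restrict (Set.Ioi (0 : ℝ))), t ≠ x :=
          ae_restrict_of_ae (Measure.ae_ne volume x)
        filter_upwards [hne] with t ht
        have hu : l * (x - t) ≠ 0 := mul_ne_zero hl.ne' (sub_ne_zero.2 ht.symm)
        have key := integral_triangle_mul_exp hu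
        rw [intervalIntegral.integral_of_le (by norm_num)] at key
        push_cast
        push_cast at key
        rw [← key, ← integral_const_mul]
        refine integral_congr_ae (ae_of_all _ fun y => ?_)
        simp only
        have : Complex.exp (-(σ + Complex.I * (l * y)) * t) =
            Complex.exp (-σ * t) * Complex.exp (-(Complex.I * l * y * t)) := by
          rw [← Complex.exp_add]
          congr 1
          ring
        rw [this]
        have h3 : Complex.exp (Complex.I * (l * (x - t) * y)) =
            Complex.exp (Complex.I * (l * x * y)) * Complex.exp (-(Complex.I * l * y * t)) := by
          rw [← Complex.exp_add]
          congr 1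
          ring
        rw [h3]
        ring

theorem integrable_fejer_comp {l : ℝ} (hl : 0 < l) (x : ℝ) :
    Integrable fun t => fejer (l * (x - t)) :=
  ((integrable_fejer.comp_mul_left' hl.ne').comp_sub_left x)

/-- Let `σ → 0` along `1 / (n + 1)`. On the left `g` is bounded on a compact rectangle; on the right
the integrable majorant is `B` times the Fejér kernel, which no longer depends on `σ`. -/
theorem integral_triangle_mul_boundary (hD : Measurable D) (hB : ∀ t, |D t| ≤ B)
    (hgc : ContinuousOn g {z | 0 ≤ z.re})
    (hg : ∀ z : ℂ, 0 < z.re → ∫ t in Set.Ioi (0 : ℝ), (D t : ℂ) * Complex.exp (-z * t) = g z)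
    {l : ℝ} (hl : 0 < l) (x : ℝ) :
    ∫ y in (-1 : ℝ)..1, ((1 - |y| : ℝ) : ℂ) * g (Complex.I * (l * y)) *
        Complex.exp (Complex.I * (l * x * y)) =
      ∫ t in Set.Ioi (0 : ℝ), ((D t * fejer (l * (x - t)) : ℝ) : ℂ) := by
  have hlim : Tendsto (fun n : ℕ => 1 / ((n : ℝ) + 1)) atTop (𝓝 0) :=
    tendsto_one_div_add_atTop_nhds_zero_nat
  have hcpt : IsCompact (Set.Icc (0 : ℝ) 1 ×ˢ Set.Icc (-1 : ℝ) 1) := isCompact_Icc.prod isCompact_Icc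
  have hmaps : ContinuousOn (fun p : ℝ × ℝ => g (p.1 + Complex.I * (l * p.2)))
      (Set.Ici (0 : ℝ) ×ˢ Set.univ) := by
    refine hgc.comp (Continuous.continuousOn (by fun_prop)) fun p hp => ?_
    simpa using hp.1
  obtain ⟨M, hM⟩ := hcpt.exists_bound_of_continuousOn
    (hmaps.mono (Set.prod_mono Set.Icc_subset_Ici_self (Set.subset_univ _)))
  have hσ1 : ∀ n : ℕ, 1 / ((n : ℝ) + 1) ∈ Set.Icc (0 : ℝ) 1 := fun n => by
    refine ⟨by positivity, ?_⟩
    rw [div_le_one (by positivity)]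
    linarith [(n.cast_nonneg : (0 : ℝ) ≤ n)]
  have hσ : ∀ n : ℕ, 0 < 1 / ((n : ℝ) + 1) := fun n => by positivity
  have hline : ∀ s : ℝ, 0 ≤ s → Continuous fun y : ℝ => g (s + Complex.I * (l * y)) := by
    intro s hs
    have : ContinuousOn (fun y : ℝ => g (s + Complex.I * (l * y))) Set.univ :=
      hmaps.comp (f := fun y : ℝ => (s, y)) (by fun_prop) fun y _ => ⟨hs, trivial⟩
    exact continuousOn_univ.1 this
  have hleft : Tendsto (fun n : ℕ => ∫ y in (-1 : ℝ)..1, ((1 - |y| : ℝ) : ℂ) *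
      g ((1 / ((n : ℝ) + 1) : ℝ) + Complex.I * (l * y)) * Complex.exp (Complex.I * (l * x * y)))
      atTop (𝓝 (∫ y in (-1 : ℝ)..1, ((1 - |y| : ℝ) : ℂ) * g (Complex.I * (l * y)) *
        Complex.exp (Complex.I * (l * x * y)))) := by
    refine intervalIntegral.tendsto_integral_filter_of_dominated_convergence (fun _ => M) ?_ ?_ ?_ ?_
    · refine Eventually.of_forall fun n => Continuous.aestronglyMeasurable ?_
      exact ((by fun_prop : Continuous fun y : ℝ => ((1 - |y| : ℝ) : ℂ)).mul
        (hline _ (hσ n).le)).mul (by fun_prop)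
    · refine Eventually.of_forall fun n => ae_of_all _ fun y hy => ?_
      rw [Set.uIoc_of_le (by norm_num)] at hy
      have h1 := hM (1 / ((n : ℝ) + 1), y) ⟨hσ1 n, hy.1.le, hy.2⟩
      have e1 : (Complex.I * (l * x * y)).re = 0 := by simp
      rw [norm_mul, norm_mul, Complex.norm_exp, e1, Real.exp_zero, mul_one]
      have h6 := norm_triangle_le hy
      calc _ ≤ 1 * ‖g ((1 / ((n : ℝ) + 1) : ℝ) + Complex.I * (l * y))‖ := by gcongr
        _ ≤ M := by rw [one_mul]; exact h1
    · simp
    · refine ae_of_all _ fun y _ => ?_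
      refine (tendsto_const_nhds.mul ?_).mul tendsto_const_nhds
      have h1 : Tendsto (fun n : ℕ => ((1 / ((n : ℝ) + 1), y) : ℝ × ℝ)) atTop
          (𝓝[Set.Ici (0 : ℝ) ×ˢ Set.univ] (0, y)) := by
        refine tendsto_nhdsWithin_iff.2 ⟨hlim.prodMk_nhds tendsto_const_nhds,
          Eventually.of_forall fun n => ⟨(hσ n).le, trivial⟩⟩
      have h2 := (hmaps (0, y) ⟨Set.mem_Ici.2 le_rfl, trivial⟩).tendsto.comp h1
      simpa [Function.comp_def] using h2
  have hright : Tendsto (fun n : ℕ => ∫ t in Set.Ioi (0 : ℝ),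
      ((D t * Real.exp (-(1 / ((n : ℝ) + 1)) * t) * fejer (l * (x - t)) : ℝ) : ℂ)) atTop
      (𝓝 (∫ t in Set.Ioi (0 : ℝ), ((D t * fejer (l * (x - t)) : ℝ) : ℂ))) := by
    refine tendsto_integral_of_dominated_convergence (fun t => B * fejer (l * (x - t))) ?_ ?_ ?_ ?_
    · intro n
      have := measurable_fejer
      exact Measurable.aestronglyMeasurable (by fun_prop)
    · exact ((integrable_fejer_comp hl x).const_mul B).integrableOn
    · intro n
      refine (ae_restrict_mem measurableSet_Ioi).mono fun t ht => ?_
      rw [Complex.norm_real, norm_mul, norm_mul, Real.norm_of_nonneg (fejer_nonneg _),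
        Real.norm_of_nonneg (Real.exp_pos _).le, Real.norm_eq_abs]
      have h1 : Real.exp (-(1 / ((n : ℝ) + 1)) * t) ≤ 1 := by
        rw [Real.exp_le_one_iff]
        have := hσ n
        have := Set.mem_Ioi.1 ht
        rw [neg_mul, neg_nonpos]
        positivity
      have h2 := fejer_nonneg (l * (x - t))
      have h3 := hB t
      calc _ ≤ |D t| * 1 * fejer (l * (x - t)) := by gcongr
        _ ≤ _ := by rw [mul_one]; gcongr
    · refine ae_of_all _ fun t => ?_
      refine (Complex.continuous_ofReal.tendsto _).comp ?_
      refine Tendsto.mul ?_ tendsto_const_nhds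
      have : Tendsto (fun n : ℕ => Real.exp (-(1 / ((n : ℝ) + 1)) * t)) atTop (𝓝 1) := by
        have h := (Real.continuous_exp.tendsto _).comp ((hlim.neg).mul_const t)
        simpa [Function.comp_def] using h
      simpa using this.const_mul (D t)
  refine tendsto_nhds_unique hleft (hright.congr fun n => ?_)
  exact (integral_triangle_mul_laplace hD hB hg hl x (hσ n)).symm

/-- On the boundary line `x` enters only as a frequency, against a fixed function supported in `[-1,
1]`, so the Riemann–Lebesgue lemma applies. -/
theorem tendsto_integral_mul_fejer (hD : Measurable D) (hB : ∀ t, |D t| ≤ B)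
    (hgc : ContinuousOn g {z | 0 ≤ z.re})
    (hg : ∀ z : ℂ, 0 < z.re → ∫ t in Set.Ioi (0 : ℝ), (D t : ℂ) * Complex.exp (-z * t) = g z)
    {l : ℝ} (hl : 0 < l) :
    Tendsto (fun x => ∫ t in Set.Ioi (0 : ℝ), D t * fejer (l * (x - t))) atTop (𝓝 0) := by
  have hRL := Real.tendsto_integral_exp_smul_cocompact
    (Set.indicator (Set.Ioc (-1 : ℝ) 1) fun y => ((1 - |y| : ℝ) : ℂ) * g (Complex.I * (l * y)))
  have hc : 0 < l / (2 * Real.pi) := by positivity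
  -- The frequency that turns `exp (-2πi v w)` into `exp (i l x v)`.
  have hcomp : Tendsto (fun x : ℝ => -(l / (2 * Real.pi)) * x) atTop (cocompact ℝ) :=
    (tendsto_id.const_mul_atTop_of_neg (neg_lt_zero.2 hc)).mono_right atBot_le_cocompact
  have h := hRL.comp hcomp
  have heq : ∀ x : ℝ, (∫ v : ℝ, Real.fourierChar (-(v * (-(l / (2 * Real.pi)) * x))) •
      Set.indicator (Set.Ioc (-1 : ℝ) 1)
        (fun y => ((1 - |y| : ℝ) : ℂ) * g (Complex.I * (l * y))) v) =
      ((∫ t in Set.Ioi (0 : ℝ), D t * fejer (l * (x - t)) : ℝ) : ℂ) := by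
    intro x
    rw [← integral_complex_ofReal, ← integral_triangle_mul_boundary hD hB hgc hg hl x,
      intervalIntegral.integral_of_le (by norm_num), ← integral_indicator measurableSet_Ioc]
    refine integral_congr_ae (ae_of_all _ fun y => ?_)
    simp only
    by_cases hy : y ∈ Set.Ioc (-1 : ℝ) 1
    · rw [Set.indicator_of_mem hy, Set.indicator_of_mem hy, Circle.smul_def,
        Real.fourierChar_apply, smul_eq_mul, mul_comm]
      congr 2
      push_cast
      have : (Real.pi : ℂ) ≠ 0 := by exact_mod_cast Real.pi_ne_zero
      field_simp
    · rw [Set.indicator_of_notMem hy, Set.indicator_of_notMem hy, smul_zero]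
  have h2 := (Complex.continuous_re.tendsto _).comp h
  refine (h2.congr fun x => ?_)
  simp only [Function.comp_apply]
  rw [heq, Complex.ofReal_re]

end Laplace

/-! ### The Tauberian argument and Wiener–Ikehara -/

section Tauberian

variable {S : ℝ → ℝ} {A B : ℝ}

theorem integrable_mul_fejer (hSm : Measurable S) (h0 : ∀ t, 0 ≤ S t) (hB : ∀ t, S t ≤ B)
    (x l : ℝ) : Integrable fun u => S (x - u / l) * fejer u := by
  refine (integrable_fejer.const_mul B).mono' ?_ (ae_of_all _ fun u => ?_)
  · have := measurable_fejer
    exact Measurable.aestronglyMeasurable (by fun_prop)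
  · rw [Real.norm_of_nonneg (mul_nonneg (h0 _) (fejer_nonneg u))]
    exact mul_le_mul_of_nonneg_right (hB _) (fejer_nonneg u)

/-- Monotonicity of `exp t * S t` prevents `S` from falling quickly. With the mean centred at `x +
δ`, the window `|u| ≤ l δ` samples `S` only on `[x, x + 2δ]`, where `S ≥ exp (-2δ) S x`. -/
theorem mul_fejer_mass_le (hSm : Measurable S) (h0 : ∀ t, 0 ≤ S t) (hB : ∀ t, S t ≤ B)
    (hmono : Monotone fun t => Real.exp t * S t) {l δ : ℝ} (hl : 0 < l) (hδ : 0 < δ) (x : ℝ) :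
    S x * Real.exp (-(2 * δ)) * ∫ u in -(l * δ)..(l * δ), fejer u ≤
      ∫ u, S (x + δ - u / l) * fejer u := by
  have hR : 0 < l * δ := by positivity
  rw [intervalIntegral.integral_of_le (by linarith), ← integral_const_mul]
  refine (setIntegral_mono_on (g := fun u => S (x + δ - u / l) * fejer u)
    (integrable_fejer.const_mul _).integrableOn
    (integrable_mul_fejer hSm h0 hB _ l).integrableOn measurableSet_Ioc fun u hu => ?_).trans
    (setIntegral_le_integral (integrable_mul_fejer hSm h0 hB _ l)
      (ae_of_all _ fun u => mul_nonneg (h0 _) (fejer_nonneg u)))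
  refine mul_le_mul_of_nonneg_right ?_ (fejer_nonneg u)
  have h1 : u / l ≤ δ := by rw [div_le_iff₀ hl]; linarith [hu.2]
  have h2 : -δ ≤ u / l := by rw [le_div_iff₀ hl]; linarith [hu.1]
  have h3 := hmono (show x ≤ x + δ - u / l by linarith)
  simp only at h3
  have h4 : S x * Real.exp (x - (x + δ - u / l)) ≤ S (x + δ - u / l) := by
    rw [Real.exp_sub, ← mul_div_assoc, div_le_iff₀ (Real.exp_pos _)]
    linarith
  refine le_trans ?_ h4
  refine mul_le_mul_of_nonneg_left (Real.exp_le_exp.2 (by linarith)) (h0 x)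

/-- The mirror image, centred at `x - δ`, so that the window samples `[x - 2δ, x]`; outside the
window only `S ≤ B` is used. -/
theorem fejer_mean_le (hSm : Measurable S) (h0 : ∀ t, 0 ≤ S t) (hB : ∀ t, S t ≤ B)
    (hmono : Monotone fun t => Real.exp t * S t) {l δ : ℝ} (hl : 0 < l) (hδ : 0 < δ) (x : ℝ) :
    ∫ u, S (x - δ - u / l) * fejer u ≤
      S x * Real.exp (2 * δ) * (∫ u in -(l * δ)..(l * δ), fejer u) +
        B * ((∫ u, fejer u) - ∫ u in -(l * δ)..(l * δ), fejer u) := by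
  have hR : 0 < l * δ := by positivity
  have hi := integrable_mul_fejer hSm h0 hB (x - δ) l
  rw [intervalIntegral.integral_of_le (by linarith)]
  rw [← integral_add_compl (μ := volume) (measurableSet_Ioc (a := -(l * δ)) (b := l * δ)) hi,
    ← integral_add_compl (μ := volume) (measurableSet_Ioc (a := -(l * δ)) (b := l * δ))
      integrable_fejer, add_sub_cancel_left, ← integral_const_mul, ← integral_const_mul]
  refine add_le_add ?_ ?_
  · refine setIntegral_mono_on hi.integrableOn (integrable_fejer.const_mul _).integrableOn
      measurableSet_Ioc fun u hu => ?_
    refine mul_le_mul_of_nonneg_right ?_ (fejer_nonneg u)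
    have h1 : u / l ≤ δ := by rw [div_le_iff₀ hl]; linarith [hu.2]
    have h2 : -δ ≤ u / l := by rw [le_div_iff₀ hl]; linarith [hu.1]
    have h3 := hmono (show x - δ - u / l ≤ x by linarith)
    simp only at h3
    have h4 : S (x - δ - u / l) ≤ S x * Real.exp (x - (x - δ - u / l)) := by
      rw [Real.exp_sub, ← mul_div_assoc, le_div_iff₀ (Real.exp_pos _)]
      linarith
    exact h4.trans (mul_le_mul_of_nonneg_left (Real.exp_le_exp.2 (by linarith)) (h0 x))
  · exact setIntegral_mono hi.integrableOn (integrable_fejer.const_mul _).integrableOn fun u =>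
      mul_le_mul_of_nonneg_right (hB _) (fejer_nonneg u)

/-- Take `l = δ⁻¹ ^ 2`. Then `l δ = 1 / δ` tends to infinity as `δ → 0`, so the window captures all
the mass while the factors `exp (±2δ)` tend to `1`. A suitable `δ` is fixed before `x → ∞`. -/
theorem tendsto_of_tendsto_fejer_mean (hSm : Measurable S) (h0 : ∀ t, 0 ≤ S t)
    (hB : ∀ t, S t ≤ B) (hmono : Monotone fun t => Real.exp t * S t)
    (hmean : ∀ l : ℝ, 0 < l → Tendsto (fun x => ∫ u, S (x - u / l) * fejer u) atTop
      (𝓝 (A * ∫ u, fejer u))) : Tendsto S atTop (𝓝 A) := by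
  set c := ∫ u, fejer u with hc
  have hcpos : 0 < c := integral_fejer_pos
  have hcR : Tendsto (fun δ : ℝ => ∫ u in -(δ⁻¹ ^ 2 * δ)..(δ⁻¹ ^ 2 * δ), fejer u) (𝓝[>] 0) (𝓝 c) := by
    have h1 : Tendsto (fun δ : ℝ => δ⁻¹) (𝓝[>] 0) atTop := tendsto_inv_nhdsGT_zero
    have h2 := intervalIntegral_tendsto_integral (μ := volume) integrable_fejer
      (tendsto_neg_atTop_atBot.comp h1) h1
    refine h2.congr' ?_
    filter_upwards [self_mem_nhdsWithin] with δ hδ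
    have : δ ≠ 0 := (Set.mem_Ioi.1 hδ).ne'
    have h3 : δ⁻¹ ^ 2 * δ = δ⁻¹ := by field_simp
    rw [h3]
    rfl
  have hid : Tendsto (fun δ : ℝ => δ) (𝓝[>] 0) (𝓝 0) := tendsto_id.mono_left nhdsWithin_le_nhds
  have hexp : ∀ a : ℝ, Tendsto (fun δ : ℝ => Real.exp (a * δ)) (𝓝[>] 0) (𝓝 1) := fun a => by
    simpa [Function.comp_def] using (Real.continuous_exp.tendsto _).comp (hid.const_mul a)
  have hpos : ∀ᶠ δ : ℝ in 𝓝[>] 0, 0 < ∫ u in -(δ⁻¹ ^ 2 * δ)..(δ⁻¹ ^ 2 * δ), fejer u :=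
    hcR.eventually (lt_mem_nhds hcpos)
  have hδpos : ∀ᶠ δ : ℝ in 𝓝[>] 0, 0 < δ := self_mem_nhdsWithin
  refine tendsto_order.2 ⟨fun a ha => ?_, fun a ha => ?_⟩
  · have hlim : Tendsto (fun δ : ℝ =>
        a * Real.exp (2 * δ) * (∫ u in -(δ⁻¹ ^ 2 * δ)..(δ⁻¹ ^ 2 * δ), fejer u) +
          B * (c - ∫ u in -(δ⁻¹ ^ 2 * δ)..(δ⁻¹ ^ 2 * δ), fejer u)) (𝓝[>] 0)
        (𝓝 (a * 1 * c + B * (c - c))) :=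
      (((hexp 2).const_mul a).mul hcR).add ((tendsto_const_nhds.sub hcR).const_mul B)
    have hlt : a * 1 * c + B * (c - c) < A * c := by nlinarith
    obtain ⟨δ, h1, h2, hδ⟩ := ((hlim.eventually (gt_mem_nhds hlt)).and (hpos.and hδpos)).exists
    have hl : 0 < δ⁻¹ ^ 2 := by positivity
    have h3 := ((hmean _ hl).comp (tendsto_atTop_add_const_right atTop (-δ) tendsto_id)).eventually
      (lt_mem_nhds h1)
    filter_upwards [h3] with x hx
    simp only [Function.comp_apply, id, ← sub_eq_add_neg] at hx
    have h4 := hx.trans_le (fejer_mean_le hSm h0 hB hmono hl hδ x)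
    have h5 := lt_of_add_lt_add_right h4
    exact lt_of_mul_lt_mul_right (lt_of_mul_lt_mul_right h5 h2.le) (Real.exp_pos _).le
  · have hlim : Tendsto (fun δ : ℝ =>
        a * Real.exp (-2 * δ) * (∫ u in -(δ⁻¹ ^ 2 * δ)..(δ⁻¹ ^ 2 * δ), fejer u)) (𝓝[>] 0)
        (𝓝 (a * 1 * c)) := ((hexp (-2)).const_mul a).mul hcR
    have hlt : A * c < a * 1 * c := by nlinarith
    obtain ⟨δ, h1, h2, hδ⟩ := ((hlim.eventually (lt_mem_nhds hlt)).and (hpos.and hδpos)).exists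
    have hl : 0 < δ⁻¹ ^ 2 := by positivity
    have h3 := ((hmean _ hl).comp (tendsto_atTop_add_const_right atTop δ tendsto_id)).eventually
      (gt_mem_nhds h1)
    filter_upwards [h3] with x hx
    simp only [Function.comp_apply, id] at hx
    have h4 := (mul_fejer_mass_le hSm h0 hB hmono hl hδ x).trans_lt hx
    rw [← neg_mul] at h4
    exact lt_of_mul_lt_mul_right (lt_of_mul_lt_mul_right h4 h2.le) (Real.exp_pos _).le

/-- A Tauberian theorem for Laplace transforms: if the Laplace transform of `S` on `(0, ∞)` minus
`A / z` extends continuously to the closed half plane, then `S` tends to `A`. -/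
theorem tendsto_of_laplace {g : ℂ → ℂ} (hSm : Measurable S) (h0 : ∀ t, 0 ≤ S t)
    (hB : ∀ t, S t ≤ B) (hneg : ∀ t < 0, S t = 0) (hmono : Monotone fun t => Real.exp t * S t)
    (hgc : ContinuousOn g {z | 0 ≤ z.re})
    (hg : ∀ z : ℂ, 0 < z.re →
      ∫ t in Set.Ioi (0 : ℝ), (S t : ℂ) * Complex.exp (-z * t) = A / z + g z) :
    Tendsto S atTop (𝓝 A) := by
  refine tendsto_of_tendsto_fejer_mean hSm h0 hB hmono fun l hl => ?_
  -- The constant `A` on the half-line has transform `A / z`, so subtracting it leaves exactly `g`.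
  set D : ℝ → ℝ := fun t => S t - (Set.Ici (0 : ℝ)).indicator (fun _ => A) t with hD
  have hDm : Measurable D := hSm.sub (measurable_const.indicator measurableSet_Ici)
  have hDB : ∀ t, |D t| ≤ B + |A| := by
    intro t
    refine (abs_sub _ _).trans (add_le_add ?_ ?_)
    · rw [abs_of_nonneg (h0 t)]
      exact hB t
    · by_cases ht : t ∈ Set.Ici (0 : ℝ)
      · rw [Set.indicator_of_mem ht]
      · rw [Set.indicator_of_notMem ht, abs_zero]
        exact abs_nonneg A
  have hDg : ∀ z : ℂ, 0 < z.re →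
      ∫ t in Set.Ioi (0 : ℝ), (D t : ℂ) * Complex.exp (-z * t) = g z := by
    intro z hz
    have hz' : (-z).re < 0 := by simpa using hz
    have hI := integrableOn_exp_mul_complex_Ioi hz' 0
    have h1 : IntegrableOn (fun t : ℝ => (S t : ℂ) * Complex.exp (-z * t)) (Set.Ioi 0) := by
      refine Integrable.bdd_mul (c := B) hI ?_ (ae_of_all _ fun t => ?_)
      · exact (Complex.measurable_ofReal.comp hSm).aestronglyMeasurable
      · rw [Complex.norm_real, Real.norm_of_nonneg (h0 t)]
        exact hB t
    have h2 : ∫ t in Set.Ioi (0 : ℝ), (D t : ℂ) * Complex.exp (-z * t) =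
        ∫ t in Set.Ioi (0 : ℝ), ((S t : ℂ) * Complex.exp (-z * t) - A * Complex.exp (-z * t)) := by
      refine setIntegral_congr_fun measurableSet_Ioi fun t ht => ?_
      have ht' : t ∈ Set.Ici (0 : ℝ) := (Set.mem_Ioi.1 ht).le
      simp only [hD, Set.indicator_of_mem ht']
      push_cast
      ring
    rw [h2, integral_sub h1 (hI.const_mul _), hg z hz, integral_const_mul,
      integral_exp_mul_complex_Ioi hz']
    have hz0 : z ≠ 0 := by
      rintro rfl
      simp at hz
    simp
    field_simp
    ring
  have key := tendsto_integral_mul_fejer hDm hDB hgc hDg hl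
  -- Substitute `u = l (x - t)`: the removed constant contributes `A` times the mass on `u ≤ l x`,
  -- which becomes the full mass as `x → ∞`.
  have hsplit : ∀ x : ℝ, ∫ u, S (x - u / l) * fejer u =
      l * (∫ t in Set.Ioi (0 : ℝ), D t * fejer (l * (x - t))) +
        A * ∫ u in Set.Iic (l * x), fejer u := by
    intro x
    have h1 : l * (∫ t in Set.Ioi (0 : ℝ), D t * fejer (l * (x - t))) =
        ∫ u, D (x - u / l) * fejer u := by
      have e1 : ∫ t in Set.Ioi (0 : ℝ), D t * fejer (l * (x - t)) =
          ∫ t, D t * fejer (l * (x - t)) := by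
        rw [← integral_Ici_eq_integral_Ioi]
        refine setIntegral_eq_integral_of_forall_compl_eq_zero fun t ht => ?_
        have : D t = 0 := by
          simp only [hD]
          rw [hneg t (not_le.1 ht), Set.indicator_of_notMem ht, sub_zero]
        rw [this, zero_mul]
      have e2 := Measure.integral_comp_div (fun v => D (x - v) * fejer (l * v)) l
      have e3 := integral_sub_left_eq_self (fun t => D t * fejer (l * (x - t))) volume x
      simp only [sub_sub_cancel] at e3
      rw [e1, ← e3]
      rw [abs_of_pos hl, smul_eq_mul] at e2
      rw [← e2]
      refine integral_congr_ae (ae_of_all _ fun u => ?_)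
      simp only
      rw [mul_div_cancel₀ _ hl.ne']
    have h2 : A * ∫ u in Set.Iic (l * x), fejer u =
        ∫ u, (Set.Iic (l * x)).indicator (fun u => A * fejer u) u := by
      rw [integral_indicator measurableSet_Iic, integral_const_mul]
    have hi2 : Integrable ((Set.Iic (l * x)).indicator fun u => A * fejer u) :=
      (integrable_fejer.const_mul A).indicator measurableSet_Iic
    have heq : ∀ u, D (x - u / l) * fejer u = S (x - u / l) * fejer u -
        (Set.Iic (l * x)).indicator (fun u => A * fejer u) u := by
      intro u
      have hiff : x - u / l ∈ Set.Ici (0 : ℝ) ↔ u ∈ Set.Iic (l * x) := by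
        rw [Set.mem_Ici, sub_nonneg, div_le_iff₀ hl, Set.mem_Iic, mul_comm]
      by_cases hu : u ∈ Set.Iic (l * x)
      · simp only [hD, Set.indicator_of_mem hu, Set.indicator_of_mem (hiff.2 hu)]
        ring
      · simp only [hD, Set.indicator_of_notMem hu, Set.indicator_of_notMem (mt hiff.1 hu)]
        ring
    rw [h1, h2]
    simp_rw [heq]
    rw [integral_sub (integrable_mul_fejer hSm h0 hB x l) hi2]
    ring
  simp_rw [hsplit]
  have hmass : Tendsto (fun x : ℝ => ∫ u in Set.Iic (l * x), fejer u) atTop (𝓝 (∫ u, fejer u)) :=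
    (aecover_Iic (tendsto_id.const_mul_atTop hl)).integral_tendsto_of_countably_generated
      integrable_fejer
  simpa using (key.const_mul l).add (hmass.const_mul A)

/-- The Wiener–Ikehara theorem, for nonnegative coefficients whose partial sums are known to be
`O(n)`. -/
theorem tendsto_sum_div_of_LSeries {f : ℕ → ℝ} (hf : ∀ n, 0 ≤ f n) {C : ℝ}
    (hC : ∀ n : ℕ, ∑ k ∈ Finset.Icc 1 n, f k ≤ C * n) {A : ℝ} {G : ℂ → ℂ}
    (hG : ContinuousOn G {s | 1 ≤ s.re})
    (heq : ∀ s : ℂ, 1 < s.re → LSeries (fun n => f n) s = G s + A / (s - 1)) :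
    Tendsto (fun x : ℝ => (∑ k ∈ Finset.Icc 1 ⌊x⌋₊, f k) / x) atTop (𝓝 A) := by
  set P : ℝ → ℝ := fun x => ∑ k ∈ Finset.Icc 1 ⌊x⌋₊, f k with hP
  have hP0 : ∀ x, 0 ≤ P x := fun x => Finset.sum_nonneg fun k _ => hf k
  have hPmono : Monotone P := fun x y hxy =>
    Finset.sum_le_sum_of_subset_of_nonneg
      (Finset.Icc_subset_Icc_right (Nat.floor_le_floor hxy)) fun k _ _ => hf k
  have hC0 : 0 ≤ C := by
    have := (hf 1).trans (by simpa using hC 1)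
    exact this
  have hPC : ∀ x, 0 ≤ x → P x ≤ C * x := fun x hx =>
    (hC _).trans (mul_le_mul_of_nonneg_left (Nat.floor_le hx) hC0)
  set S : ℝ → ℝ := fun t => Real.exp (-t) * P (Real.exp t) with hS
  have hSP : ∀ t, Real.exp t * S t = P (Real.exp t) := fun t => by
    simp only [hS]
    rw [← mul_assoc, ← Real.exp_add, add_neg_cancel, Real.exp_zero, one_mul]
  have hbig : (fun n : ℕ => ∑ k ∈ Finset.Icc 1 n, f k) =O[atTop] fun n => (n : ℝ) ^ (1 : ℝ) := by
    refine IsBigO.of_bound C (Eventually.of_forall fun n => ?_)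
    rw [Real.rpow_one, Real.norm_of_nonneg (Finset.sum_nonneg fun k _ => hf k),
      Real.norm_of_nonneg n.cast_nonneg]
    exact hC n
  have hlim : Tendsto S atTop (𝓝 A) := by
    -- The transform of `S` is the L-series at `1 + z` divided by `1 + z`, and `A / (z (1 + z)) = A
    -- / z - A / (1 + z)`.
    refine tendsto_of_laplace (B := C) (g := fun z => (G (1 + z) - A) / (1 + z)) ?_ ?_ ?_ ?_ ?_ ?_ ?_
    · exact (Real.measurable_exp.comp measurable_neg).mul
        (hPmono.measurable.comp Real.measurable_exp)
    · exact fun t => mul_nonneg (Real.exp_pos _).le (hP0 _)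
    · intro t
      have h := hPC _ (Real.exp_pos t).le
      rw [← hSP, mul_comm C] at h
      exact le_of_mul_le_mul_left h (Real.exp_pos t)
    · intro t ht
      have h : ⌊Real.exp t⌋₊ = 0 := Nat.floor_eq_zero.2 (Real.exp_lt_one_iff.2 ht)
      simp [hS, hP, h]
    · simp_rw [hSP]
      exact hPmono.comp Real.exp_monotone
    · refine ContinuousOn.div ((hG.comp (by fun_prop) fun z hz => ?_).sub continuousOn_const)
        (by fun_prop) fun z hz h => ?_
      · simpa using hz
      · have h1 := congrArg Complex.re h
        have h2 : 0 ≤ z.re := hz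
        simp at h1
        linarith
    · intro z hz
      have h1 : (1 : ℝ) < (1 + z).re := by simpa using hz
      -- Abel summation writes the L-series as `s ∫ P(x) x^{-s-1} dx` over `x > 1`; the substitution
      -- `x = exp t` makes this a Laplace transform.
      have h2 := LSeries_eq_mul_integral_of_nonneg f zero_le_one h1 hbig hf
      have h3 := integral_comp_exp_Ioi
        (fun x : ℝ => (∑ k ∈ Finset.Icc 1 ⌊x⌋₊, (f k : ℂ)) * (x : ℂ) ^ (-((1 + z) + 1))) 0
      rw [Real.exp_zero] at h3
      have h4 : ∫ t in Set.Ioi (0 : ℝ), (S t : ℂ) * Complex.exp (-z * t) =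
          LSeries (fun n => f n) (1 + z) / (1 + z) := by
        have h5 : (1 + z) ≠ 0 := by
          intro h
          rw [h] at h1
          simp at h1
          linarith
        rw [h2, ← h3, mul_div_cancel_left₀ _ h5]
        refine integral_congr_ae (ae_of_all _ fun t => ?_)
        simp only [hS, hP]
        rw [Complex.cpow_def_of_ne_zero (by exact_mod_cast (Real.exp_pos t).ne'),
          ← Complex.ofReal_log (Real.exp_pos t).le, Real.log_exp, Complex.real_smul]
        push_cast
        have h6 : Complex.exp (t * -(1 + z + 1)) =
            Complex.exp (-t) * Complex.exp (-t) * Complex.exp (-z * t) := by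
          rw [← Complex.exp_add, ← Complex.exp_add]
          congr 1
          ring
        have h7 : Complex.exp t * Complex.exp (-t) = 1 := by
          rw [← Complex.exp_add, add_neg_cancel, Complex.exp_zero]
        rw [h6]
        linear_combination (-(Complex.exp (-t) * Complex.exp (-z * t) *
          ∑ k ∈ Finset.Icc 1 ⌊Real.exp t⌋₊, (f k : ℂ))) * h7
      rw [h4, heq _ h1]
      have hz0 : z ≠ 0 := by
        rintro rfl
        simp at hz
      have h5 : (1 + z) ≠ 0 := by
        intro h
        rw [h] at h1
        simp at h1
        linarith
      rw [add_sub_cancel_left]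
      field_simp
      ring
  refine (hlim.comp Real.tendsto_log_atTop).congr' ?_
  filter_upwards [eventually_gt_atTop 0] with x hx
  simp only [Function.comp_apply, hS]
  rw [Real.exp_neg, Real.exp_log hx, inv_mul_eq_div]

end Tauberian

/-! ### The prime number theorem in arithmetic progressions -/

section PrimesInProgression

open ArithmeticFunction.vonMangoldt

variable {q : ℕ} {a : ZMod q}

/-- The primes up to `x` in the residue class `a`. -/
noncomputable def primesInClass (a : ZMod q) (x : ℝ) : Finset ℕ :=
  (Finset.Ioc 0 ⌊x⌋₊).filter fun n => n.Prime ∧ (n : ZMod q) = a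

/-- Wiener–Ikehara for the von Mangoldt function restricted to the class. Chebyshev's bound on `ψ`
gives the a priori linear growth, and the series minus its pole extends continuously to `Re s ≥ 1`.
-/
theorem tendsto_sum_residueClass_div [NeZero q] (ha : IsUnit a) :
    Tendsto (fun x : ℝ => (∑ k ∈ Finset.Icc 1 ⌊x⌋₊, residueClass a k) / x) atTop
      (𝓝 (q.totient : ℝ)⁻¹) := by
  refine tendsto_sum_div_of_LSeries (residueClass_nonneg a) (C := Real.log 4 + 4)
    (G := LFunctionResidueClassAux a) (fun n => ?_)
    (continuousOn_LFunctionResidueClassAux a) fun s hs => ?_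
  · have h := Chebyshev.psi_le_const_mul_self n.cast_nonneg
    rw [Chebyshev.psi, Nat.floor_natCast] at h
    exact (Finset.sum_le_sum fun k _ => residueClass_le a k).trans h
  · rw [eqOn_LFunctionResidueClassAux ha hs]
    push_cast
    ring

theorem tendsto_psi_sub_theta_div :
    Tendsto (fun x : ℝ => (Chebyshev.psi x - Chebyshev.theta x) / x) atTop (𝓝 0) := by
  refine (Chebyshev.isBigO_psi_sub_theta_sqrt.trans_isLittleO ?_).tendsto_div_nhds_zero
  refine (isLittleO_iff_tendsto' ?_).2 ?_
  · filter_upwards [eventually_gt_atTop 0] with x hx h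
    exact absurd h hx.ne'
  · simp_rw [Real.sqrt_div_self']
    simpa [Pi.inv_def] using Real.tendsto_sqrt_atTop.inv_tendsto_atTop

theorem tendsto_primeCounting_mul_log_sub_theta_div :
    Tendsto (fun x : ℝ => (Nat.primeCounting ⌊x⌋₊ * Real.log x - Chebyshev.theta x) / x) atTop
      (𝓝 0) := by
  have h1 := Chebyshev.primeCounting_sub_theta_div_log_isBigO.mul
    (isBigO_refl (fun x : ℝ => Real.log x / x) atTop)
  have h2 : Tendsto (fun x : ℝ => x / Real.log x ^ 2 * (Real.log x / x)) atTop (𝓝 0) := by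
    refine Real.tendsto_log_atTop.inv_tendsto_atTop.congr' ?_
    filter_upwards [eventually_gt_atTop 1] with x hx
    have := Real.log_pos hx
    simp only [Pi.inv_apply]
    field_simp
  refine (h1.trans_tendsto h2).congr' ?_
  filter_upwards [eventually_gt_atTop 1] with x hx
  have := Real.log_pos hx
  field_simp

/-- The comparison is termwise: a prime `n` in the class costs `log x - log n`, a non-prime there
costs `Λ(n)`. Summed over all `n ≤ x`, these costs are the two differences on the right, so no
estimate specific to the class is needed. -/
theorem abs_card_primesInClass_mul_log_sub_le {x : ℝ} (hx : 1 ≤ x) :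
    |(primesInClass a x).card * Real.log x - ∑ k ∈ Finset.Icc 1 ⌊x⌋₊, residueClass a k| ≤
      (Nat.primeCounting ⌊x⌋₊ * Real.log x - Chebyshev.theta x) +
        (Chebyshev.psi x - Chebyshev.theta x) := by
  classical
  have hpi : (Nat.primeCounting ⌊x⌋₊ : ℝ) * Real.log x =
      ∑ n ∈ Finset.Ioc 0 ⌊x⌋₊, if n.Prime then Real.log x else 0 := by
    rw [← Finset.sum_filter, Finset.sum_const, nsmul_eq_mul, Nat.primeCounting,
      Nat.primeCounting', Nat.count_eq_card_filter_range]
    congr 3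
    ext n
    simp only [Finset.mem_filter, Finset.mem_range, Finset.mem_Ioc]
    constructor
    · exact fun h => ⟨⟨h.2.pos, by omega⟩, h.2⟩
    · exact fun h => ⟨by omega, h.2⟩
  have hcard : ((primesInClass a x).card : ℝ) * Real.log x =
      ∑ n ∈ Finset.Ioc 0 ⌊x⌋₊, if n.Prime ∧ (n : ZMod q) = a then Real.log x else 0 := by
    rw [← Finset.sum_filter, Finset.sum_const, nsmul_eq_mul, primesInClass]
  have hIcc : Finset.Icc 1 ⌊x⌋₊ = Finset.Ioc 0 ⌊x⌋₊ := rfl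
  rw [hpi, hcard, hIcc, Chebyshev.theta, Chebyshev.psi, Finset.sum_filter,
    ← Finset.sum_sub_distrib, ← Finset.sum_sub_distrib, ← Finset.sum_sub_distrib,
    ← Finset.sum_add_distrib]
  refine (Finset.abs_sum_le_sum_abs _ _).trans (Finset.sum_le_sum fun n hn => ?_)
  obtain ⟨hn0, hnx⟩ := Finset.mem_Ioc.1 hn
  have hnx' : (n : ℝ) ≤ x := (Nat.le_floor_iff (by linarith)).1 hnx
  have hlog : Real.log n ≤ Real.log x := Real.log_le_log (by exact_mod_cast hn0) hnx'
  have h0 : 0 ≤ ArithmeticFunction.vonMangoldt n := ArithmeticFunction.vonMangoldt_nonneg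
  by_cases hp : n.Prime <;> by_cases hc : (n : ZMod q) = a
  · simp [hp, hc, ArithmeticFunction.vonMangoldt_apply_prime hp,
      abs_of_nonneg (sub_nonneg.2 hlog)]
  · simp [hp, hc, ArithmeticFunction.vonMangoldt_apply_prime hp, hlog]
  · simp [hp, hc, abs_of_nonneg h0]
  · simp [hp, hc, h0]

/-- The prime number theorem in arithmetic progressions. -/
theorem tendsto_card_primesInClass_mul_log_div [NeZero q] (ha : IsUnit a) :
    Tendsto (fun x : ℝ => (primesInClass a x).card * Real.log x / x) atTop
      (𝓝 (q.totient : ℝ)⁻¹) := by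
  have h1 := tendsto_primeCounting_mul_log_sub_theta_div.add tendsto_psi_sub_theta_div
  rw [add_zero] at h1
  have h2 : Tendsto (fun x : ℝ => ((primesInClass a x).card * Real.log x -
      ∑ k ∈ Finset.Icc 1 ⌊x⌋₊, residueClass a k) / x) atTop (𝓝 0) := by
    refine squeeze_zero_norm' ?_ h1
    filter_upwards [eventually_ge_atTop 1] with x hx
    have hx0 : 0 < x := by linarith
    rw [norm_div, Real.norm_of_nonneg hx0.le, Real.norm_eq_abs, ← add_div]
    exact div_le_div_of_nonneg_right (abs_card_primesInClass_mul_log_sub_le hx) hx0.le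
  have h3 := h2.add (tendsto_sum_residueClass_div ha)
  rw [zero_add] at h3
  refine h3.congr fun x => ?_
  rw [← add_div, sub_add_cancel]

end PrimesInProgression

/-! ### Local components, primitivity and order -/

section LocalComponents

variable {q : ℕ} [NeZero q]

instance neZero_ordProj (p : q.primeFactors) : NeZero ((p : ℕ) ^ q.factorization p) :=
  ⟨pow_ne_zero _ (Nat.prime_of_mem_primeFactors p.2).ne_zero⟩

/-- The Chinese remainder isomorphism on units. -/
noncomputable def unitsEquivPi (q : ℕ) [NeZero q] :
    (ZMod q)ˣ ≃* (∀ p : q.primeFactors, (ZMod ((p : ℕ) ^ q.factorization p))ˣ) :=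
  (Units.mapEquiv (ZMod.equivPi q (NeZero.ne q)).toMulEquiv).trans MulEquiv.piUnits

theorem unitsEquivPi_apply (u : (ZMod q)ˣ) (p : q.primeFactors) :
    unitsEquivPi q u p = ZMod.unitsMap (Nat.ordProj_dvd q p) u := by
  symm
  ext
  exact RingHom.congr_fun (Subsingleton.elim
    (ZMod.castHom (Nat.ordProj_dvd q p) (ZMod ((p : ℕ) ^ q.factorization p)))
    ((Pi.evalRingHom (fun p : q.primeFactors => ZMod ((p : ℕ) ^ q.factorization p)) p).comp
      (ZMod.equivPi q (NeZero.ne q)).toRingHom)) (u : ZMod q)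

theorem localInclusion_apply (p : q.primeFactors) (u : (ZMod ((p : ℕ) ^ q.factorization p))ˣ) :
    localInclusion q p u = (unitsEquivPi q).symm (Pi.mulSingle p u) := rfl

theorem unitsMap_localInclusion_self (p : q.primeFactors)
    (u : (ZMod ((p : ℕ) ^ q.factorization p))ˣ) :
    ZMod.unitsMap (Nat.ordProj_dvd q p) (localInclusion q p u) = u := by
  rw [← unitsEquivPi_apply, localInclusion_apply, MulEquiv.apply_symm_apply, Pi.mulSingle_eq_same]

theorem unitsMap_localInclusion_of_ne {p p' : q.primeFactors} (h : p' ≠ p)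
    (u : (ZMod ((p : ℕ) ^ q.factorization p))ˣ) :
    ZMod.unitsMap (Nat.ordProj_dvd q p') (localInclusion q p u) = 1 := by
  rw [← unitsEquivPi_apply, localInclusion_apply, MulEquiv.apply_symm_apply,
    Pi.mulSingle_eq_of_ne h]

theorem localComponent_toUnitHom (χ : DirichletCharacter ℂ q) (p : q.primeFactors) :
    (localComponent χ p).toUnitHom = χ.toUnitHom.comp (localInclusion q p) := by
  simp [localComponent]

/-- Passing to the local component, as a homomorphism. -/
noncomputable def localComponentHom (p : q.primeFactors) :
    DirichletCharacter ℂ q →* DirichletCharacter ℂ ((p : ℕ) ^ q.factorization p) where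
  toFun χ := localComponent χ p
  map_one' := by
    ext u
    simp [localComponent]
  map_mul' χ ψ := by
    ext u
    simp [localComponent]

theorem localComponentHom_apply (p : q.primeFactors) (χ : DirichletCharacter ℂ q) :
    localComponentHom p χ = localComponent χ p := rfl

theorem localComponent_changeLevel_self (p : q.primeFactors)
    (ψ : DirichletCharacter ℂ ((p : ℕ) ^ q.factorization p)) :
    localComponent (DirichletCharacter.changeLevel (Nat.ordProj_dvd q p) ψ) p = ψ := by
  apply MulChar.ext
  intro u
  rw [← MulChar.coe_toUnitHom, ← MulChar.coe_toUnitHom, localComponent_toUnitHom,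
    DirichletCharacter.changeLevel_toUnitHom, MonoidHom.comp_apply, MonoidHom.comp_apply,
    unitsMap_localInclusion_self]

theorem localComponent_changeLevel_of_ne {p p' : q.primeFactors} (h : p' ≠ p)
    (ψ : DirichletCharacter ℂ ((p' : ℕ) ^ q.factorization p')) :
    localComponent (DirichletCharacter.changeLevel (Nat.ordProj_dvd q p') ψ) p = 1 := by
  apply MulChar.ext
  intro u
  rw [← MulChar.coe_toUnitHom, localComponent_toUnitHom,
    DirichletCharacter.changeLevel_toUnitHom, MonoidHom.comp_apply, MonoidHom.comp_apply,
    unitsMap_localInclusion_of_ne h, map_one, MulChar.one_apply_coe, Units.val_one]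

/-- A character modulo `q` is the same as the family of its local components. -/
noncomputable def localComponentsEquiv (q : ℕ) [NeZero q] : DirichletCharacter ℂ q ≃
    (∀ p : q.primeFactors, DirichletCharacter ℂ ((p : ℕ) ^ q.factorization p)) where
  toFun χ p := localComponent χ p
  invFun ψ := ∏ p : q.primeFactors, DirichletCharacter.changeLevel (Nat.ordProj_dvd q p) (ψ p)
  left_inv χ := (eq_prod_localComponent χ).symm
  right_inv ψ := by
    funext p
    simp only
    rw [← localComponentHom_apply, map_prod, Finset.prod_eq_single p]
    · exact localComponent_changeLevel_self p (ψ p)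
    · exact fun p' _ h => localComponent_changeLevel_of_ne h (ψ p')
    · simp

theorem ordProj_div_dvd (p : q.primeFactors) :
    (p : ℕ) ^ (q.factorization p - 1) ∣ q / p := by
  have hp := Nat.prime_of_mem_primeFactors p.2
  have hv : q.factorization p ≠ 0 :=
    (hp.factorization_pos_of_dvd (NeZero.ne q) (Nat.dvd_of_mem_primeFactors p.2)).ne'
  refine Nat.dvd_div_of_mul_dvd ?_
  rw [mul_pow_sub_one hv]
  exact Nat.ordProj_dvd q p

omit [NeZero q] in
theorem ordProj_dvd_div {p p' : q.primeFactors} (h : p' ≠ p) :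
    (p' : ℕ) ^ q.factorization p' ∣ q / p := by
  have hp := Nat.prime_of_mem_primeFactors p.2
  have hp' := Nat.prime_of_mem_primeFactors p'.2
  refine Nat.dvd_div_of_mul_dvd (Nat.Coprime.mul_dvd_of_dvd_of_dvd ?_
    (Nat.dvd_of_mem_primeFactors p.2) (Nat.ordProj_dvd q p'))
  exact Nat.Coprime.pow_right _ ((Nat.coprime_primes hp hp').2 fun e => h (Subtype.ext e.symm))

/-- Lift to an integer `n` and test `q / p ∣ n - 1` one prime power at a time. Away from `p` the
local inclusion is `1`; at `p` the exponent has dropped by one, which is what `hu` covers. -/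
theorem unitsMap_div_localInclusion (p : q.primeFactors)
    (u : (ZMod ((p : ℕ) ^ q.factorization p))ˣ)
    (hu : ZMod.unitsMap (Nat.pow_dvd_pow (p : ℕ) (Nat.sub_le (q.factorization p) 1)) u = 1) :
    ZMod.unitsMap (Nat.div_dvd_of_dvd (Nat.dvd_of_mem_primeFactors p.2))
      (localInclusion q p u) = 1 := by
  have hp := Nat.prime_of_mem_primeFactors p.2
  set x := localInclusion q p u with hx
  obtain ⟨n, hn⟩ : ∃ n : ℕ, (n : ZMod q) = x := ⟨(x : ZMod q).val, ZMod.natCast_zmod_val _⟩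
  have hcast : ∀ {d : ℕ} (hd : d ∣ q), ((ZMod.unitsMap hd x : (ZMod d)ˣ) : ZMod d) = (n : ZMod d) :=
    fun hd => by rw [ZMod.unitsMap_val, ← hn, ZMod.cast_natCast hd]
  have hdvd : ∀ {d : ℕ} (hd : d ∣ q), ZMod.unitsMap hd x = 1 ↔ d ∣ ((n : ℤ) - 1).natAbs := by
    intro d hd
    rw [Units.ext_iff, hcast hd, Units.val_one, ← Int.natCast_dvd, ← ZMod.intCast_zmod_eq_zero_iff_dvd]
    push_cast
    rw [sub_eq_zero]
  rw [hdvd, Nat.dvd_iff_prime_pow_dvd_dvd]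
  intro r k hr hk
  rcases Nat.eq_zero_or_pos k with rfl | hk0
  · simp
  have hrq : r ∈ q.primeFactors := Nat.mem_primeFactors.2 ⟨hr, (dvd_pow_self r hk0.ne').trans
    (hk.trans (Nat.div_dvd_of_dvd (Nat.dvd_of_mem_primeFactors p.2))), NeZero.ne q⟩
  have hq0 : q / p ≠ 0 := (Nat.div_pos (Nat.le_of_dvd (NeZero.pos q)
    (Nat.dvd_of_mem_primeFactors p.2)) hp.pos).ne'
  have hkle := (hr.pow_dvd_iff_le_factorization hq0).1 hk
  rw [Nat.factorization_div (Nat.dvd_of_mem_primeFactors p.2), hp.factorization] at hkle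
  by_cases h : (⟨r, hrq⟩ : q.primeFactors) = p
  · subst h
    simp only [Finsupp.coe_tsub, Pi.sub_apply, Finsupp.single_eq_same] at hkle
    refine (pow_dvd_pow r hkle).trans ?_
    rw [← hdvd ((pow_dvd_pow r (Nat.sub_le _ 1)).trans (Nat.ordProj_dvd q r))]
    rw [← hu, ← ZMod.unitsMap_comp (pow_dvd_pow r (Nat.sub_le _ 1)) (Nat.ordProj_dvd q r),
      MonoidHom.comp_apply, hx, unitsMap_localInclusion_self ⟨r, hrq⟩ u]
  · have hk2 : k ≤ q.factorization r := hkle.trans (by simp)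
    refine (pow_dvd_pow r hk2).trans ?_
    rw [← hdvd (Nat.ordProj_dvd q r)]
    exact unitsMap_localInclusion_of_ne h u

theorem prod_localInclusion_unitsMap (u : (ZMod q)ˣ) :
    ∏ p : q.primeFactors, localInclusion q p (ZMod.unitsMap (Nat.ordProj_dvd q p) u) = u := by
  simp_rw [← unitsEquivPi_apply, localInclusion_apply]
  rw [← map_prod, Finset.univ_prod_mulSingle, MulEquiv.symm_apply_apply]

/-- Passing from `q` to `q / p` affects only the factor at `p`: the local inclusion carries the
kernel of reduction to `p ^ (v - 1)` onto the kernel of reduction to `q / p`. -/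
theorem factorsThrough_div_iff (χ : DirichletCharacter ℂ q) (p : q.primeFactors) :
    χ.FactorsThrough (q / p) ↔
      (localComponent χ p).FactorsThrough ((p : ℕ) ^ (q.factorization p - 1)) := by
  rw [DirichletCharacter.factorsThrough_iff_ker_unitsMap
      (Nat.div_dvd_of_dvd (Nat.dvd_of_mem_primeFactors p.2)),
    DirichletCharacter.factorsThrough_iff_ker_unitsMap
      (Nat.pow_dvd_pow (p : ℕ) (Nat.sub_le (q.factorization p) 1))]
  constructor
  · intro h u hu
    rw [MonoidHom.mem_ker, localComponent_toUnitHom, MonoidHom.comp_apply]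
    exact h (unitsMap_div_localInclusion p u hu)
  · intro h x hx
    have hx1 : localInclusion q p (ZMod.unitsMap (Nat.ordProj_dvd q p) x) = x := by
      conv_rhs => rw [← prod_localInclusion_unitsMap x]
      symm
      refine Finset.prod_eq_single p (fun p' _ hne => ?_) (by simp)
      have : ZMod.unitsMap (Nat.ordProj_dvd q p') x = 1 := by
        rw [← ZMod.unitsMap_comp (ordProj_dvd_div hne)
          (Nat.div_dvd_of_dvd (Nat.dvd_of_mem_primeFactors p.2)), MonoidHom.comp_apply,
          MonoidHom.mem_ker.1 hx, map_one]
      rw [this, map_one]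
    have hx2 : ZMod.unitsMap (Nat.pow_dvd_pow (p : ℕ) (Nat.sub_le (q.factorization p) 1))
        (ZMod.unitsMap (Nat.ordProj_dvd q p) x) = 1 := by
      rw [← MonoidHom.comp_apply, ZMod.unitsMap_comp, ← ZMod.unitsMap_comp (ordProj_div_dvd p)
        (Nat.div_dvd_of_dvd (Nat.dvd_of_mem_primeFactors p.2)), MonoidHom.comp_apply,
        MonoidHom.mem_ker.1 hx, map_one]
    have := h hx2
    rwa [MonoidHom.mem_ker, localComponent_toUnitHom, MonoidHom.comp_apply, hx1] at this

/-- A proper divisor of `q` divides some `q / p`, so only these maximal proper divisors need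
testing. -/
theorem isPrimitive_iff_not_factorsThrough_div (χ : DirichletCharacter ℂ q) :
    χ.IsPrimitive ↔ ∀ p : q.primeFactors, ¬ χ.FactorsThrough (q / p) := by
  have hc := χ.conductor_dvd_level
  have hq := NeZero.ne q
  constructor
  · intro h p hp
    have hpp := Nat.prime_of_mem_primeFactors p.2
    have hd := DirichletCharacter.conductor_dvd_of_mem_conductorSet χ hp
    rw [DirichletCharacter.isPrimitive_def] at h
    rw [h] at hd
    exact absurd (Nat.le_of_dvd (Nat.div_pos (Nat.le_of_dvd (NeZero.pos q)
      (Nat.dvd_of_mem_primeFactors p.2)) hpp.pos) hd)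
      (not_le.2 (Nat.div_lt_self (NeZero.pos q) hpp.one_lt))
  · intro h
    rw [DirichletCharacter.isPrimitive_def]
    obtain ⟨m, hm⟩ := hc
    by_contra hne
    have hm1 : m ≠ 1 := by
      rintro rfl
      exact hne (by rw [mul_one] at hm; exact hm.symm)
    obtain ⟨p, hp, k, rfl⟩ := Nat.exists_prime_and_dvd hm1
    have hpq : p ∈ q.primeFactors :=
      Nat.mem_primeFactors.2 ⟨hp, ⟨χ.conductor * k, hm.trans (mul_left_comm _ _ _)⟩, hq⟩
    refine h ⟨p, hpq⟩ ?_
    rw [← DirichletCharacter.mem_conductorSet_iff,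
      DirichletCharacter.mem_conductorSet_iff_conductor_dvd _
        (Nat.div_dvd_of_dvd (Nat.dvd_of_mem_primeFactors hpq))]
    refine Nat.dvd_div_of_mul_dvd ⟨k, ?_⟩
    exact hm.trans ((mul_left_comm _ _ _).trans (mul_assoc _ _ _).symm)

theorem isPrimitive_prime_pow_iff {p v : ℕ} (hp : p.Prime) (hv : v ≠ 0)
    (ψ : DirichletCharacter ℂ (p ^ v)) :
    ψ.IsPrimitive ↔ ¬ ψ.FactorsThrough (p ^ (v - 1)) := by
  have : NeZero (p ^ v) := ⟨pow_ne_zero _ hp.ne_zero⟩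
  have hdiv : p ^ v / p = p ^ (v - 1) := by
    rw [← mul_pow_sub_one hv p, Nat.mul_div_cancel_left _ hp.pos]
  rw [isPrimitive_iff_not_factorsThrough_div]
  have hmem : ∀ r, r ∈ (p ^ v).primeFactors ↔ r = p := by
    intro r
    rw [Nat.primeFactors_prime_pow hv hp, Finset.mem_singleton]
  constructor
  · intro h
    have := h ⟨p, (hmem p).2 rfl⟩
    rwa [hdiv] at this
  · rintro h ⟨r, hr⟩
    obtain rfl := (hmem r).1 hr
    rwa [hdiv]

theorem isPrimitive_iff_localComponent (χ : DirichletCharacter ℂ q) :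
    χ.IsPrimitive ↔ ∀ p : q.primeFactors, (localComponent χ p).IsPrimitive := by
  rw [isPrimitive_iff_not_factorsThrough_div]
  refine forall_congr' fun p => ?_
  have hp := Nat.prime_of_mem_primeFactors p.2
  rw [factorsThrough_div_iff, isPrimitive_prime_pow_iff hp
    (hp.factorization_pos_of_dvd (NeZero.ne q) (Nat.dvd_of_mem_primeFactors p.2)).ne']

/-- The order is the least common multiple of the local orders. For `q = 1` there are no components,
and the hypothesis on them would be vacuous. -/
theorem orderOf_eq_of_localComponent {l : ℕ} (hq : q ≠ 1) {χ : DirichletCharacter ℂ q}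
    (h : ∀ p : q.primeFactors, orderOf (localComponent χ p) = l) : orderOf χ = l := by
  refine Nat.dvd_antisymm (orderOf_dvd_of_pow_eq_one ?_) ?_
  · apply (localComponentsEquiv q).injective
    funext p
    change localComponentHom p (χ ^ l) = localComponentHom p 1
    rw [map_pow, map_one, localComponentHom_apply, ← h p, pow_orderOf_eq_one]
  · obtain ⟨r, hr, hrq⟩ := Nat.exists_prime_and_dvd hq
    have hmem : r ∈ q.primeFactors := Nat.mem_primeFactors.2 ⟨hr, hrq, NeZero.ne q⟩
    rw [← h ⟨r, hmem⟩, ← localComponentHom_apply]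
    exact orderOf_map_dvd _ χ

theorem card_isPrimitive_orderOf_localComponent (l : ℕ) :
    Nat.card {χ : DirichletCharacter ℂ q //
      χ.IsPrimitive ∧ ∀ p : q.primeFactors, orderOf (localComponent χ p) = l} =
    ∏ p : q.primeFactors, Nat.card {ψ : DirichletCharacter ℂ ((p : ℕ) ^ q.factorization p) //
      ψ.IsPrimitive ∧ orderOf ψ = l} := by
  rw [← Nat.card_pi]
  refine Nat.card_congr ((Equiv.subtypeEquiv (localComponentsEquiv q) fun χ => ?_).trans
    (Equiv.subtypePiEquivPi (p := fun (p : q.primeFactors)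
      (ψ : DirichletCharacter ℂ ((p : ℕ) ^ q.factorization p)) =>
      ψ.IsPrimitive ∧ orderOf ψ = l)))
  rw [isPrimitive_iff_localComponent, ← forall_and]
  rfl

end LocalComponents

/-! ### Counting characters of order 6 modulo prime powers -/

section LocalCounts

theorem card_orderOf_dirichletCharacter {N : ℕ} [NeZero N] [IsCyclic (ZMod N)ˣ] (l : ℕ) :
    Nat.card {ψ : DirichletCharacter ℂ N // orderOf ψ = l} =
      if l ∣ N.totient then l.totient else 0 := by
  obtain ⟨e⟩ := DirichletCharacter.mulEquiv_units ℂ N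
  have h1 : Nat.card {ψ : DirichletCharacter ℂ N // orderOf ψ = l} =
      Nat.card {u : (ZMod N)ˣ // orderOf u = l} :=
    Nat.card_congr (e.toEquiv.subtypeEquiv fun ψ => by
      rw [← MulEquiv.orderOf_eq e ψ]
      rfl)
  rw [h1]
  split_ifs with h
  · rw [← ZMod.card_units_eq_totient] at h
    rw [← IsCyclic.card_orderOf_eq_totient h, Nat.card_eq_fintype_card, Fintype.card_subtype]
  · rw [Nat.card_eq_zero]
    refine Or.inl ⟨fun u => h ?_⟩
    rw [← u.2, ← ZMod.card_units_eq_totient]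
    exact orderOf_dvd_card

theorem card_orderOf_prime_pow {p : ℕ} (hp : p.Prime) {l : ℕ} (hl : l = 6) (v : ℕ) :
    Nat.card {ψ : DirichletCharacter ℂ (p ^ v) // orderOf ψ = l} =
      if l ∣ (p ^ v).totient then 2 else 0 := by
  have : NeZero (p ^ v) := ⟨pow_ne_zero _ hp.ne_zero⟩
  subst hl
  -- For `p = 2` the unit group need not be cyclic, but its order is a power of two, which excludes
  -- elements of order 6.
  by_cases h2 : p = 2
  · subst h2
    have hnd : ¬ 6 ∣ (2 ^ v).totient := by
      intro h
      have h3 : 3 ∣ (2 ^ v).totient := (by norm_num : 3 ∣ 6).trans h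
      rcases Nat.eq_zero_or_pos v with rfl | hv
      · simp at h3
      · rw [Nat.totient_prime_pow hp hv] at h3
        simp only [Nat.add_one_sub_one, mul_one] at h3
        have := Nat.Prime.dvd_of_dvd_pow Nat.prime_three h3
        omega
    rw [if_neg hnd, Nat.card_eq_zero]
    obtain ⟨e⟩ := DirichletCharacter.mulEquiv_units ℂ (2 ^ v)
    refine Or.inl ⟨fun ψ => hnd ?_⟩
    rw [← ψ.2, ← ZMod.card_units_eq_totient, ← MulEquiv.orderOf_eq e ψ.1]
    exact orderOf_dvd_card
  · have := ZMod.isCyclic_units_of_prime_pow p hp h2 v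
    rw [card_orderOf_dirichletCharacter 6]
    rfl

/-- The imprimitive characters are exactly those induced from `p ^ (v - 1)`, and induction is
injective and preserves order. -/
theorem card_isPrimitive_add_card_orderOf {p : ℕ} (hp : p.Prime) (l : ℕ) {v : ℕ} (hv : v ≠ 0) :
    Nat.card {ψ : DirichletCharacter ℂ (p ^ v) // ψ.IsPrimitive ∧ orderOf ψ = l} +
      Nat.card {ψ : DirichletCharacter ℂ (p ^ (v - 1)) // orderOf ψ = l} =
    Nat.card {ψ : DirichletCharacter ℂ (p ^ v) // orderOf ψ = l} := by
  have : NeZero (p ^ v) := ⟨pow_ne_zero _ hp.ne_zero⟩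
  have : NeZero (p ^ (v - 1)) := ⟨pow_ne_zero _ hp.ne_zero⟩
  set c := DirichletCharacter.changeLevel (R := ℂ) (Nat.pow_dvd_pow p (Nat.sub_le v 1)) with hc
  have hinj : Function.Injective c := DirichletCharacter.changeLevel_injective _
  have h1 : {ψ : DirichletCharacter ℂ (p ^ v) | orderOf ψ = l} =
      {ψ | ψ.IsPrimitive ∧ orderOf ψ = l} ∪
        c '' {ψ : DirichletCharacter ℂ (p ^ (v - 1)) | orderOf ψ = l} := by
    ext ψ
    simp only [Set.mem_ofPred_eq, Set.mem_union, Set.mem_image]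
    constructor
    · intro h
      by_cases hψ : ψ.IsPrimitive
      · exact Or.inl ⟨hψ, h⟩
      · rw [isPrimitive_prime_pow_iff hp hv, not_not] at hψ
        obtain ⟨hd, χ, rfl⟩ := hψ
        refine Or.inr ⟨χ, ?_, rfl⟩
        rw [← h, orderOf_injective _ hinj]
    · rintro (h | ⟨χ, h, rfl⟩)
      · exact h.2
      · rw [orderOf_injective _ hinj, h]
  have h2 : Disjoint {ψ : DirichletCharacter ℂ (p ^ v) | ψ.IsPrimitive ∧ orderOf ψ = l}
      (c '' {ψ : DirichletCharacter ℂ (p ^ (v - 1)) | orderOf ψ = l}) := by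
    rw [Set.disjoint_left]
    rintro _ ⟨h, -⟩ ⟨χ, -, rfl⟩
    rw [isPrimitive_prime_pow_iff hp hv] at h
    exact h (DirichletCharacter.changeLevel_factorsThrough _ _)
  have h3 := Set.ncard_union_eq h2 (Set.toFinite _) (Set.toFinite _)
  rw [← h1, Set.ncard_image_of_injective _ hinj] at h3
  exact h3.symm

/-- The number of primitive characters of order `6` modulo `p ^ k`, for `p` prime and `k ≠ 0`. -/
def localCount (p k : ℕ) : ℕ :=
  if p = 3 then (if k = 2 then 2 else 0) else if p % 3 = 1 ∧ k = 1 then 2 else 0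

/-- Subtracting the counts at `v` and `v - 1` leaves only the first exponent with `6 ∣ φ(p ^ v)`:
this is `2` for `p = 3`, `1` for `p ≡ 1 (mod 3)`, and never occurs otherwise. -/
theorem card_isPrimitive_orderOf_prime_pow {p : ℕ} (hp : p.Prime) {v : ℕ} (hv : v ≠ 0) :
    Nat.card {ψ : DirichletCharacter ℂ (p ^ v) // ψ.IsPrimitive ∧ orderOf ψ = 6} =
      localCount p v := by
  have h := card_isPrimitive_add_card_orderOf hp 6 hv
  rw [card_orderOf_prime_pow hp rfl, card_orderOf_prime_pow hp rfl] at h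
  rw [Nat.eq_sub_of_add_eq h]
  have key : ∀ w : ℕ, 6 ∣ (p ^ w).totient ↔ (p = 3 ∧ 2 ≤ w) ∨ (p % 3 = 1 ∧ 1 ≤ w) := by
    intro w
    rcases Nat.eq_zero_or_pos w with rfl | hw
    · simp
    rw [Nat.totient_prime_pow hp hw]
    by_cases h3 : p = 3
    · subst h3
      rcases Nat.lt_or_ge w 2 with hw2 | hw2
      · obtain rfl : w = 1 := by omega
        simp
      · obtain ⟨k, rfl⟩ : ∃ k, w = k + 2 := ⟨w - 2, by omega⟩
        simp only [true_and, show k + 2 - 1 = k + 1 by omega, pow_succ]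
        constructor
        · intro _
          left
          omega
        · intro _
          exact ⟨3 ^ k, by ring⟩
    · have hcop : Nat.Coprime 3 (p ^ (w - 1)) :=
        Nat.Coprime.pow_right _ ((Nat.coprime_primes Nat.prime_three hp).2 (Ne.symm h3))
      constructor
      · intro h6
        right
        have : 3 ∣ p - 1 := hcop.dvd_of_dvd_mul_left ((by norm_num : 3 ∣ 6).trans h6)
        have := hp.one_lt
        omega
      · rintro (h' | ⟨h', -⟩)
        · exact absurd h'.1 h3
        · refine Dvd.dvd.mul_left ?_ _
          rcases hp.eq_two_or_odd with rfl | h2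
          · omega
          · omega
  simp only [key, localCount]
  by_cases h3 : p = 3
  · subst h3
    simp
    split_ifs <;> omega
  · simp [h3]
    split_ifs <;> omega

/-- The number of totally sextic characters of conductor `q ≠ 1`, as a product of local counts. -/
def sexticCount (q : ℕ) : ℕ := ∏ p ∈ q.primeFactors, localCount p (q.factorization p)

theorem ncard_totalChars (q : ℕ+) :
    {χ : DirichletCharacter ℂ (q : ℕ) | (⟨q, χ⟩ : Σ q : ℕ+, DirichletCharacter ℂ (q : ℕ)) ∈
      totalChars 6}.ncard = if (q : ℕ) = 1 then 0 else sexticCount q := by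
  -- At `q = 1` the empty product `sexticCount 1` is `1`, but the only character there has order 1.
  split_ifs with hq
  · rw [Set.ncard_eq_zero (Set.toFinite _), Set.eq_empty_iff_forall_notMem]
    rintro χ ⟨⟨-, h⟩, -⟩
    have : χ = 1 := DirichletCharacter.level_one' χ hq
    simp [this] at h
  · have h1 : {χ : DirichletCharacter ℂ (q : ℕ) | (⟨q, χ⟩ : Σ q : ℕ+, DirichletCharacter ℂ (q : ℕ)) ∈
        totalChars 6} = {χ | χ.IsPrimitive ∧
          ∀ p : (q : ℕ).primeFactors, orderOf (localComponent χ p) = 6} := by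
      ext χ
      constructor
      · rintro ⟨⟨h1, h2⟩, h3 | h3⟩
        · simp only at h2 h3
          simp [h3] at h2
        · exact ⟨h1, h3.2⟩
      · rintro ⟨h1, h2⟩
        have h3 := orderOf_eq_of_localComponent hq h2
        exact ⟨⟨h1, h3⟩, Or.inr ⟨h3, h2⟩⟩
    rw [h1, sexticCount]
    refine (card_isPrimitive_orderOf_localComponent 6).trans ?_
    rw [← Finset.prod_coe_sort (q : ℕ).primeFactors fun p => localCount p ((q : ℕ).factorization p)]
    refine Finset.prod_congr rfl fun p _ => ?_
    have hp := Nat.prime_of_mem_primeFactors p.2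
    exact card_isPrimitive_orderOf_prime_pow hp
      (hp.factorization_pos_of_dvd q.ne_zero (Nat.dvd_of_mem_primeFactors p.2)).ne'

theorem ncard_primeConductorChars (q : ℕ+) :
    {χ : DirichletCharacter ℂ (q : ℕ) | (⟨q, χ⟩ : Σ q : ℕ+, DirichletCharacter ℂ (q : ℕ)) ∈
      primeConductorChars 6}.ncard = if (q : ℕ).Prime ∧ ((q : ℕ) : ZMod 6) = 1 then 2 else 0 := by
  by_cases hq : (q : ℕ).Prime
  · have h1 : {χ : DirichletCharacter ℂ (q : ℕ) |
        (⟨q, χ⟩ : Σ q : ℕ+, DirichletCharacter ℂ (q : ℕ)) ∈ primeConductorChars 6} =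
          {χ | χ.IsPrimitive ∧ orderOf χ = 6} := by
      ext χ
      constructor
      · exact fun h => h.1
      · intro h
        refine ⟨h, ?_⟩
        have := h.1
        rw [DirichletCharacter.isPrimitive_def] at this
        simp only
        rwa [this]
    rw [h1]
    have h2 := card_isPrimitive_orderOf_prime_pow hq one_ne_zero
    have h3 : ∀ m : ℕ, m = q → Nat.card {ψ : DirichletCharacter ℂ m //
        ψ.IsPrimitive ∧ orderOf ψ = 6} = Nat.card {ψ : DirichletCharacter ℂ q //
        ψ.IsPrimitive ∧ orderOf ψ = 6} := by
      rintro m rfl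
      rfl
    rw [h3 _ (pow_one _)] at h2
    refine Eq.trans h2 ?_
    -- A prime that is `1` modulo `3` is automatically odd.
    have h4 : (((q : ℕ) : ZMod 6) = 1) ↔ (q : ℕ) % 3 = 1 := by
      have h5 : ((q : ℕ) : ZMod 6) = ((1 : ℕ) : ZMod 6) ↔ _ := ZMod.natCast_eq_natCast_iff _ _ _
      rw [Nat.cast_one] at h5
      rw [h5, Nat.ModEq]
      rcases hq.eq_two_or_odd with h | h <;> omega
    by_cases h6 : (q : ℕ) = 3 <;> by_cases h7 : (q : ℕ) % 3 = 1
    · omega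
    · simp only [h4, h7, and_false, if_false, localCount, if_pos h6]
      rfl
    all_goals simp [localCount, hq, h4, h6, h7]
  · rw [if_neg fun h => hq h.1, Set.ncard_eq_zero (Set.toFinite _),
      Set.eq_empty_iff_forall_notMem]
    rintro χ ⟨⟨h, -⟩, h2⟩
    simp only [DirichletCharacter.isPrimitive_def] at h h2
    rw [h] at h2
    exact hq h2

/-- Primitivity identifies conductor and modulus, so the bound on the conductor cuts the family into
finitely many finite fibres. -/
theorem countUpTo_eq_sum {F : Set (Σ q : ℕ+, DirichletCharacter ℂ (q : ℕ))}
    (hF : ∀ χ ∈ F, χ.2.IsPrimitive) {N : ℕ → ℕ}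
    (hN : ∀ q : ℕ+, {χ : DirichletCharacter ℂ (q : ℕ) |
      (⟨q, χ⟩ : Σ q : ℕ+, DirichletCharacter ℂ (q : ℕ)) ∈ F}.ncard = N q) {X : ℝ} (hX : 0 ≤ X) :
    countUpTo F X = ∑ q ∈ Finset.Icc 1 ⌊X⌋₊, N q := by
  classical
  set s : Finset ℕ+ := (Finset.Icc 1 ⌊X⌋₊).preimage (fun q : ℕ+ => (q : ℕ))
    PNat.coe_injective.injOn with hs
  have hmem : ∀ q : ℕ+, q ∈ s ↔ ((q : ℕ) : ℝ) ≤ X := by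
    intro q
    rw [hs, Finset.mem_preimage, Finset.mem_Icc, Nat.le_floor_iff hX]
    exact ⟨fun h => h.2, fun h => ⟨q.pos, h⟩⟩
  have hset : {χ | χ ∈ F ∧ (χ.2.conductor : ℝ) ≤ X} = ((s.sigma fun q =>
      (Set.toFinite {χ : DirichletCharacter ℂ (q : ℕ) |
        (⟨q, χ⟩ : Σ q : ℕ+, DirichletCharacter ℂ (q : ℕ)) ∈ F}).toFinset : Finset _) :
        Set (Σ q : ℕ+, DirichletCharacter ℂ (q : ℕ))) := by
    ext ⟨q, χ⟩
    simp only [Set.mem_ofPred_eq, Finset.coe_sigma, Set.mem_sigma_iff, Finset.mem_coe, hmem,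
      Set.Finite.coe_toFinset]
    constructor
    · rintro ⟨h1, h2⟩
      have h3 : χ.conductor = q := hF _ h1
      rw [h3] at h2
      exact ⟨h2, h1⟩
    · rintro ⟨h2, h1⟩
      have h3 : χ.conductor = q := hF _ h1
      rw [h3]
      exact ⟨h1, h2⟩
  rw [countUpTo, hset, Set.ncard_coe_finset, Finset.card_sigma]
  rw [← Finset.sum_preimage (fun q : ℕ+ => (q : ℕ)) (Finset.Icc 1 ⌊X⌋₊)
    PNat.coe_injective.injOn N]
  · refine Finset.sum_congr rfl fun q _ => ?_
    rw [← hN q, Set.ncard_eq_toFinset_card _ (Set.toFinite _)]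
  · intro n hn hn'
    exact absurd ⟨⟨n, (Finset.mem_Icc.1 hn).1⟩, rfl⟩ hn'

end LocalCounts

/-! ### Mean values of multiplicative functions by convolution -/

section MeanValues

/-- The multiplicative function with prescribed values at prime powers. -/
noncomputable def ofPrimePowers (c : ℕ → ℕ → ℝ) : ArithmeticFunction ℝ :=
  ⟨fun n => if n = 0 then 0 else ∏ p ∈ n.primeFactors, c p (n.factorization p), if_pos rfl⟩

theorem ofPrimePowers_apply (c : ℕ → ℕ → ℝ) {n : ℕ} (hn : n ≠ 0) :
    ofPrimePowers c n = ∏ p ∈ n.primeFactors, c p (n.factorization p) := if_neg hn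

theorem isMultiplicative_ofPrimePowers (c : ℕ → ℕ → ℝ) : (ofPrimePowers c).IsMultiplicative := by
  refine ArithmeticFunction.IsMultiplicative.iff_ne_zero.2 ⟨?_, fun {m n} hm hn hmn => ?_⟩
  · rw [ofPrimePowers_apply c one_ne_zero]
    simp
  · rw [ofPrimePowers_apply c (mul_ne_zero hm hn), ofPrimePowers_apply c hm,
      ofPrimePowers_apply c hn, hmn.primeFactors_mul,
      Finset.prod_union hmn.disjoint_primeFactors]
    congr 1
    · refine Finset.prod_congr rfl fun p hp => ?_
      rw [Nat.factorization_eq_of_coprime_left hmn (by simpa using hp)]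
    · refine Finset.prod_congr rfl fun p hp => ?_
      rw [Nat.factorization_eq_of_coprime_right hmn (by simpa using hp)]

theorem ofPrimePowers_prime_pow (c : ℕ → ℕ → ℝ) {p : ℕ} (hp : p.Prime) {k : ℕ} (hk : k ≠ 0) :
    ofPrimePowers c (p ^ k) = c p k := by
  rw [ofPrimePowers_apply c (pow_ne_zero _ hp.ne_zero), Nat.primeFactors_prime_pow hk hp,
    Finset.prod_singleton, hp.factorization_pow, Finsupp.single_eq_same]

/-- The Euler factor of `d` is `1 / (1 - d(p) x)`; `hrec` says coefficientwise that the factor of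
`g` times `1 - d(p) x` is the factor of `h`. -/
theorem mul_eq_of_prime_pow_recurrence {d h g : ArithmeticFunction ℝ} (hd : d.IsMultiplicative)
    (hh : h.IsMultiplicative) (hg : g.IsMultiplicative)
    (hpow : ∀ p k : ℕ, p.Prime → d (p ^ k) = d p ^ k)
    (hrec : ∀ p k : ℕ, p.Prime → g (p ^ (k + 1)) = d p * g (p ^ k) + h (p ^ (k + 1))) :
    d * h = g := by
  rw [ArithmeticFunction.IsMultiplicative.eq_iff_eq_on_prime_powers _ (hd.mul hh) _ hg]
  intro p k hp
  have hsum : ∀ k : ℕ, (d * h) (p ^ k) = ∑ j ∈ Finset.range (k + 1), d p ^ (k - j) * h (p ^ j) := by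
    intro k
    rw [ArithmeticFunction.mul_apply, Nat.sum_divisorsAntidiagonal' (fun a b => d a * h b),
      Nat.sum_divisors_prime_pow hp]
    refine Finset.sum_congr rfl fun j hj => ?_
    have hj' : j ≤ k := Nat.lt_succ_iff.1 (Finset.mem_range.1 hj)
    rw [Nat.pow_div hj' hp.pos, hpow p _ hp]
  induction k with
  | zero => rw [pow_zero, (hd.mul hh).map_one, hg.map_one]
  | succ k ih =>
    rw [hrec p k hp, ← ih, hsum, hsum, Finset.sum_range_succ, Nat.sub_self, pow_zero, one_mul,
      Finset.mul_sum]
    congr 1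
    refine Finset.sum_congr rfl fun j hj => ?_
    have hj' : j ≤ k := Nat.lt_succ_iff.1 (Finset.mem_range.1 hj)
    rw [Nat.sub_add_comm hj', pow_succ']
    ring

/-- The nontrivial character modulo `3`, as a real arithmetic function. -/
noncomputable def charThree : ArithmeticFunction ℝ :=
  ⟨fun n => if n % 3 = 1 then 1 else if n % 3 = 2 then -1 else 0, by simp⟩

theorem charThree_apply (n : ℕ) :
    charThree n = if n % 3 = 1 then 1 else if n % 3 = 2 then -1 else 0 := rfl

theorem charThree_mul (m n : ℕ) : charThree (m * n) = charThree m * charThree n := by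
  simp only [charThree_apply, Nat.mul_mod m n 3]
  have hm : m % 3 < 3 := Nat.mod_lt _ (by norm_num)
  have hn : n % 3 < 3 := Nat.mod_lt _ (by norm_num)
  interval_cases m % 3 <;> interval_cases n % 3 <;> norm_num

theorem isMultiplicative_charThree : charThree.IsMultiplicative :=
  ⟨by simp [charThree_apply], fun _ => charThree_mul _ _⟩

theorem charThree_pow (n k : ℕ) : charThree (n ^ k) = charThree n ^ k := by
  induction k with
  | zero => simp [charThree_apply]
  | succ k ih => rw [pow_succ, charThree_mul, ih, pow_succ]

/-- The convolution `ζ * χ₃`. -/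
noncomputable def zetaCharThree : ArithmeticFunction ℝ :=
  charThree * (ArithmeticFunction.zeta : ArithmeticFunction ℝ)

/-- Partial sums of `χ₃(d) b(d)`, grouped in pairs. -/
theorem sum_range_charThree_mul (b : ℕ → ℝ) (K : ℕ) :
    ∑ d ∈ Finset.range (3 * K), charThree d * b d =
      ∑ k ∈ Finset.range K, (b (3 * k + 1) - b (3 * k + 2)) := by
  induction K with
  | zero => simp
  | succ K ih =>
    rw [show 3 * (K + 1) = 3 * K + 1 + 1 + 1 by ring, Finset.sum_range_succ, Finset.sum_range_succ,
      Finset.sum_range_succ, ih, Finset.sum_range_succ]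
    have h0 : charThree (3 * K) = 0 := by
      rw [charThree_apply, if_neg (by omega), if_neg (by omega)]
    have h1 : charThree (3 * K + 1) = 1 := by
      rw [charThree_apply, if_pos (by omega)]
    have h2 : charThree (3 * K + 1 + 1) = -1 := by
      rw [charThree_apply, if_neg (by omega), if_pos (by omega)]
    rw [h0, h1, h2]
    ring

theorem sum_zetaCharThree_eq {N K : ℕ} (hK : N < 3 * K) :
    ∑ n ∈ Finset.Ioc 0 N, zetaCharThree n =
      ∑ k ∈ Finset.range K, (((N / (3 * k + 1) : ℕ) : ℝ) - ((N / (3 * k + 2) : ℕ) : ℝ)) := by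
  rw [zetaCharThree, ArithmeticFunction.sum_Ioc_mul_zeta_eq_sum,
    ← sum_range_charThree_mul (fun d => ((N / d : ℕ) : ℝ))]
  refine Finset.sum_subset (fun d hd => ?_) fun d hd hd' => ?_
  · rw [Finset.mem_Ioc] at hd
    rw [Finset.mem_range]
    omega
  · rw [Finset.mem_Ioc] at hd'
    rcases Nat.eq_zero_or_pos d with rfl | h
    · simp
    · rw [Nat.div_eq_of_lt (by omega)]
      simp

theorem natDiv_antitone (N : ℕ) {a b : ℕ} (ha : 0 < a) (h : a ≤ b) :
    ((N / b : ℕ) : ℝ) ≤ ((N / a : ℕ) : ℝ) := by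
  exact_mod_cast Nat.div_le_div_left h ha

theorem sum_range_alternating_natDiv_le (N : ℕ) {M K : ℕ} (hMK : M ≤ K) :
    ∑ k ∈ Finset.Ico M K, (((N / (3 * k + 1) : ℕ) : ℝ) - ((N / (3 * k + 2) : ℕ) : ℝ)) ≤
      ((N / (3 * M + 1) : ℕ) : ℝ) - ((N / (3 * K + 1) : ℕ) : ℝ) := by
  induction K, hMK using Nat.le_induction with
  | base => simp
  | succ K hK ih =>
    rw [Finset.sum_Ico_succ_top hK]
    have := natDiv_antitone N (show 0 < 3 * K + 2 by omega) (show 3 * K + 2 ≤ 3 * (K + 1) + 1 by omega)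
    linarith

/-- The sum is `∑ χ₃(d) ⌊N / d⌋`, alternating in sign with decreasing terms once multiples of `3`
are dropped. Hence its tail lies between `0` and its first term. -/
theorem sum_zetaCharThree_bounds (N M : ℕ) :
    ∑ k ∈ Finset.range M, (((N / (3 * k + 1) : ℕ) : ℝ) - ((N / (3 * k + 2) : ℕ) : ℝ)) ≤
      ∑ n ∈ Finset.Ioc 0 N, zetaCharThree n ∧
    ∑ n ∈ Finset.Ioc 0 N, zetaCharThree n ≤
      ∑ k ∈ Finset.range M, (((N / (3 * k + 1) : ℕ) : ℝ) - ((N / (3 * k + 2) : ℕ) : ℝ)) +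
        N / (3 * M + 1) := by
  have hMK : M ≤ M + N + 1 := by omega
  rw [sum_zetaCharThree_eq (show N < 3 * (M + N + 1) by omega),
    ← Finset.sum_range_add_sum_Ico _ hMK]
  constructor
  · refine le_add_of_nonneg_right (Finset.sum_nonneg fun k _ => sub_nonneg.2 ?_)
    exact natDiv_antitone N (by omega) (by omega)
  · refine add_le_add le_rfl ((sum_range_alternating_natDiv_le N hMK).trans ?_)
    have h1 : ((N / (3 * M + 1) : ℕ) : ℝ) ≤ (N : ℝ) / ((3 * M + 1 : ℕ) : ℝ) := Nat.cast_div_le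
    push_cast at h1
    linarith [(Nat.cast_nonneg (N / (3 * (M + N + 1) + 1)) : (0 : ℝ) ≤ _)]

theorem abs_sum_zetaCharThree_le (N : ℕ) : |∑ n ∈ Finset.Ioc 0 N, zetaCharThree n| ≤ N := by
  have h := sum_zetaCharThree_bounds N 0
  simp only [Finset.range_zero, Finset.sum_empty, Nat.cast_zero, mul_zero, zero_add, div_one] at h
  rw [abs_of_nonneg h.1]
  exact h.2

theorem tendsto_natDiv_div (d : ℕ) :
    Tendsto (fun N : ℕ => ((N / d : ℕ) : ℝ) / N) atTop (𝓝 (d : ℝ)⁻¹) := by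
  have h := (tendsto_nat_floor_mul_div_atTop (R := ℝ) (a := (d : ℝ)⁻¹) (by positivity)).comp
    tendsto_natCast_atTop_atTop
  refine h.congr fun N => ?_
  simp only [Function.comp_apply]
  rw [inv_mul_eq_div, Nat.floor_div_natCast, Nat.floor_natCast]

theorem summable_alternating :
    Summable fun k : ℕ => ((3 * k + 1 : ℝ)⁻¹ - (3 * k + 2 : ℝ)⁻¹) := by
  refine Summable.of_nonneg_of_le (fun k => ?_) (fun k => ?_)
    ((summable_nat_add_iff 1).2 (Real.summable_one_div_nat_pow.2 one_lt_two))
  · rw [sub_nonneg]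
    gcongr
    norm_num
  · rw [inv_sub_inv (by positivity) (by positivity)]
    rw [div_le_div_iff₀ (by positivity) (by positivity)]
    push_cast
    nlinarith [(k.cast_nonneg : (0 : ℝ) ≤ k)]

/-- The limit is `L(1, χ₃)`, a sum of positive paired terms. The series is truncated at a fixed `M`,
with error at most `1 / (3M + 1)` uniformly in `N`; `M` is chosen before `N → ∞`. -/
theorem exists_tendsto_sum_zetaCharThree_div : ∃ L : ℝ, 0 < L ∧
    Tendsto (fun N : ℕ => (∑ n ∈ Finset.Ioc 0 N, zetaCharThree n) / N) atTop (𝓝 L) := by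
  set t : ℕ → ℝ := fun k => (3 * k + 1 : ℝ)⁻¹ - (3 * k + 2 : ℝ)⁻¹ with ht
  have ht0 : ∀ k, 0 < t k := fun k => by
    rw [ht, sub_pos]
    gcongr
    norm_num
  refine ⟨∑' k, t k, summable_alternating.tsum_pos (fun k => (ht0 k).le) 0 (ht0 0), ?_⟩
  have hfin : ∀ M : ℕ, Tendsto (fun N : ℕ => (∑ k ∈ Finset.range M,
      (((N / (3 * k + 1) : ℕ) : ℝ) - ((N / (3 * k + 2) : ℕ) : ℝ))) / N) atTop
      (𝓝 (∑ k ∈ Finset.range M, t k)) := by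
    intro M
    simp_rw [Finset.sum_div]
    refine tendsto_finsetSum _ fun k _ => ?_
    have h := (tendsto_natDiv_div (3 * k + 1)).sub (tendsto_natDiv_div (3 * k + 2))
    push_cast at h
    simpa only [← sub_div] using h
  have hpart := summable_alternating.hasSum.tendsto_sum_nat
  have htail : Tendsto (fun M : ℕ => (1 : ℝ) / (3 * M + 1)) atTop (𝓝 0) := by
    have h1 : Tendsto (fun M : ℕ => (3 * M + 1 : ℝ)) atTop atTop :=
      tendsto_atTop_add_const_right _ _ (tendsto_natCast_atTop_atTop.const_mul_atTop (by norm_num))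
    simpa [Pi.inv_def] using h1.inv_tendsto_atTop
  refine tendsto_order.2 ⟨fun a ha => ?_, fun a ha => ?_⟩
  · obtain ⟨M, hM⟩ := (hpart.eventually (lt_mem_nhds ha)).exists
    filter_upwards [(hfin M).eventually (lt_mem_nhds hM)] with N hN
    exact hN.trans_le (div_le_div_of_nonneg_right (sum_zetaCharThree_bounds N M).1 N.cast_nonneg)
  · have h1 := hpart.add htail
    rw [add_zero] at h1
    obtain ⟨M, hM⟩ := (h1.eventually (gt_mem_nhds ha)).exists
    have h2 := (hfin M).add_const ((1 : ℝ) / (3 * M + 1))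
    filter_upwards [h2.eventually (gt_mem_nhds hM), eventually_gt_atTop 0] with N hN hN0
    refine lt_of_le_of_lt ?_ hN
    have hN' : (0 : ℝ) < N := by exact_mod_cast hN0
    refine (div_le_div_of_nonneg_right (sum_zetaCharThree_bounds N M).2 hN'.le).trans (le_of_eq ?_)
    field_simp

/-- If the partial sums of `r` are `O(N)` and asymptotic to `L N`, and `∑ |h d| / d` converges,
then the partial sums of `h * r` are asymptotic to `L (∑ h d / d) N`. -/
theorem tendsto_sum_mul_div {h r : ArithmeticFunction ℝ} {L : ℝ}
    (hh : Summable fun d : ℕ => ‖h d * (d : ℝ)⁻¹‖)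
    (hr : ∀ N : ℕ, |∑ n ∈ Finset.Ioc 0 N, r n| ≤ N)
    (hL : Tendsto (fun N : ℕ => (∑ n ∈ Finset.Ioc 0 N, r n) / N) atTop (𝓝 L)) :
    Tendsto (fun N : ℕ => (∑ n ∈ Finset.Ioc 0 N, (h * r) n) / N) atTop
      (𝓝 (∑' d : ℕ, h d * (d : ℝ)⁻¹ * L)) := by
  set R : ℕ → ℝ := fun N => ∑ n ∈ Finset.Ioc 0 N, r n with hR
  have h1 : ∀ N : ℕ, (∑ n ∈ Finset.Ioc 0 N, (h * r) n) / N = ∑' d : ℕ, h d * R (N / d) / N := by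
    intro N
    rw [ArithmeticFunction.sum_Ioc_mul_eq_sum_sum, Finset.sum_div]
    refine (tsum_eq_sum fun d hd => ?_).symm
    rw [Finset.mem_Ioc] at hd
    rcases Nat.eq_zero_or_pos d with rfl | hd0
    · simp
    · rw [Nat.div_eq_of_lt (by omega)]
      simp
  simp_rw [h1]
  -- The majorant is `|h d| / d`, because `|R (N / d)| ≤ N / d`.
  refine tendsto_tsum_of_dominated_convergence hh (fun d => ?_) (Eventually.of_forall fun N d => ?_)
  · rcases Nat.eq_zero_or_pos d with rfl | hd0
    · simp
    · have h2 : Tendsto (fun N : ℕ => N / d) atTop atTop :=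
        Nat.tendsto_div_const_atTop hd0.ne'
      have h3 := ((hL.comp h2).mul (tendsto_natDiv_div d)).const_mul (h d)
      rw [mul_assoc, mul_comm _ L]
      refine h3.congr' ?_
      filter_upwards [h2.eventually (eventually_gt_atTop 0)] with N hN
      have : ((N / d : ℕ) : ℝ) ≠ 0 := by exact_mod_cast hN.ne'
      simp only [Function.comp_apply]
      field_simp
      rfl
  · rw [norm_div, norm_mul, norm_mul, mul_div_assoc]
    refine mul_le_mul_of_nonneg_left ?_ (norm_nonneg _)
    rw [Real.norm_natCast, norm_inv, Real.norm_natCast]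
    rcases Nat.eq_zero_or_pos N with rfl | hN
    · simp
    · have hN' : (0 : ℝ) < N := by exact_mod_cast hN
      rw [div_le_iff₀ hN', inv_mul_eq_div]
      exact (hr _).trans Nat.cast_div_le

end MeanValues

/-! ### Convergence and positivity of Euler products -/

section EulerProduct

/-- If the local series of a multiplicative function are `1 + O(1 / p ^ 2)`, the function is
summable. -/
theorem summable_norm_of_prime_pow {F : ℕ → ℝ} (h0 : F 0 = 0) (h1 : F 1 = 1)
    (hmul : ∀ {m n : ℕ}, m.Coprime n → F (m * n) = F m * F n)
    (hsum : ∀ {p : ℕ}, p.Prime → Summable fun k : ℕ => ‖F (p ^ k)‖) {C : ℝ}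
    (hC : ∀ {p : ℕ}, p.Prime → ∑' k : ℕ, ‖F (p ^ k)‖ ≤ 1 + C / (p : ℝ) ^ 2) (hC0 : 0 ≤ C) :
    Summable fun n => ‖F n‖ := by
  have hs : Summable fun n : ℕ => C / (n : ℝ) ^ 2 := by
    exact ((Real.summable_one_div_nat_pow.2 one_lt_two).mul_left C).congr fun n => mul_one_div _ _
  refine summable_of_sum_range_le (c := Real.exp (∑' n : ℕ, C / (n : ℝ) ^ 2))
    (fun n => norm_nonneg _) fun N => ?_
  obtain ⟨h2, h3⟩ := EulerProduct.summable_and_hasSum_factoredNumbers_prod_filter_prime_tsum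
    (f := fun n => ‖F n‖) (by simp [h1]) (fun h => by rw [hmul h, norm_mul])
    (fun hp => by simpa using hsum hp) (Finset.range N)
  -- Every nonzero `n < N` has all its prime factors below `N`, so a finite Euler product dominates
  -- the partial sum.
  have h4 : ∑ n ∈ Finset.range N, ‖F n‖ ≤ ∑' m : Nat.factoredNumbers (Finset.range N), ‖F m‖ := by
    rw [tsum_subtype (Nat.factoredNumbers (Finset.range N)) fun n => ‖F n‖]
    have h5 : Summable ((Nat.factoredNumbers (Finset.range N)).indicator fun n => ‖F n‖) := by
      rw [← summable_subtype_iff_indicator]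
      exact h3.summable
    refine le_trans (Finset.sum_le_sum fun n hn => ?_) (h5.sum_le_tsum (Finset.range N)
      fun n _ => Set.indicator_nonneg (fun _ _ => norm_nonneg _) n)
    rcases Nat.eq_zero_or_pos n with rfl | hn0
    · rw [h0, norm_zero]
      exact Set.indicator_nonneg (fun _ _ => norm_nonneg _) 0
    · rw [Set.indicator_of_mem]
      refine Nat.mem_factoredNumbers_of_primeFactors_subset hn0.ne' fun p hp => ?_
      exact Finset.mem_range.2 ((Nat.le_of_mem_primeFactors hp).trans_lt (Finset.mem_range.1 hn))
  refine h4.trans ?_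
  rw [h3.tsum_eq]
  calc _ ≤ ∏ p ∈ Finset.range N with p.Prime, Real.exp (C / (p : ℝ) ^ 2) := by
        refine Finset.prod_le_prod (fun p _ => tsum_nonneg fun k => norm_nonneg _) fun p hp => ?_
        have := Real.add_one_le_exp (C / (p : ℝ) ^ 2)
        linarith [hC (Finset.mem_filter.1 hp).2]
    _ = Real.exp (∑ p ∈ Finset.range N with p.Prime, C / (p : ℝ) ^ 2) := (Real.exp_sum _ _).symm
    _ ≤ _ := Real.exp_le_exp.2 (hs.sum_le_tsum _ fun n _ => by positivity)

/-- A convergent Euler product with positive factors is positive. -/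
theorem tsum_pos_of_prime_pow {F : ℕ → ℝ} (h0 : F 0 = 0) (h1 : F 1 = 1)
    (hmul : ∀ {m n : ℕ}, m.Coprime n → F (m * n) = F m * F n)
    (hsum : Summable fun n => ‖F n‖) {C : ℝ}
    (hC : ∀ {p : ℕ}, p.Prime → |∑' k : ℕ, F (p ^ k) - 1| ≤ C / (p : ℝ) ^ 2)
    (hpos : ∀ {p : ℕ}, p.Prime → 0 < ∑' k : ℕ, F (p ^ k)) :
    0 < ∑' n, F n := by
  rw [← EulerProduct.eulerProduct_tprod h1 hmul hsum h0]
  have hs : Summable fun p : Nat.Primes => C / ((p : ℕ) : ℝ) ^ 2 := by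
    have : Summable fun n : ℕ => C / (n : ℝ) ^ 2 := by
      exact ((Real.summable_one_div_nat_pow.2 one_lt_two).mul_left C).congr fun n => mul_one_div _ _
    exact this.comp_injective Subtype.val_injective
  have hs2 : Summable fun p : Nat.Primes => (∑' k : ℕ, F ((p : ℕ) ^ k) - 1) :=
    Summable.of_norm_bounded hs fun p => hC p.2
  have hlog := Real.summable_log_one_add_of_summable hs2
  simp only [add_sub_cancel] at hlog
  rw [← Real.rexp_tsum_eq_tprod (fun p : Nat.Primes => hpos p.2) hlog]
  exact Real.exp_pos _

end EulerProduct

/-! ### The mean value of the sextic count -/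

section SexticMeanValue

/-- Coefficients of the Euler factors of `sexticCount` divided by those of `ζ(s) L(s, χ₃)`. -/
def quotientCoeff (p : ℕ) : ℕ → ℝ
  | 0 => 1
  | 1 => if p % 3 = 0 then -1 else 0
  | 2 => if p % 3 = 1 then -3 else if p % 3 = 2 then -1 else 2
  | 3 => if p % 3 = 1 then 2 else if p % 3 = 2 then 0 else -2
  | _ + 4 => 0

/-- Coefficients of the Euler factors of `sexticCount` divided by those of `ζ(s)`. -/
def zetaQuotientCoeff (p : ℕ) : ℕ → ℝ
  | 0 => 1
  | 1 => if p % 3 = 1 then 1 else -1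
  | 2 => if p % 3 = 1 then -2 else if p % 3 = 2 then 0 else 2
  | 3 => if p % 3 = 0 then -2 else 0
  | _ + 4 => 0

theorem ofPrimePowers_prime_pow_of_zero {c : ℕ → ℕ → ℝ} {p : ℕ} (hp : p.Prime) (h : c p 0 = 1)
    (k : ℕ) : ofPrimePowers c (p ^ k) = c p k := by
  rcases Nat.eq_zero_or_pos k with rfl | hk
  · rw [pow_zero, (isMultiplicative_ofPrimePowers c).map_one, h]
  · exact ofPrimePowers_prime_pow c hp hk.ne'

theorem prime_mod_three_eq_zero_iff {p : ℕ} (hp : p.Prime) : p % 3 = 0 ↔ p = 3 := by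
  rw [← Nat.dvd_iff_mod_eq_zero, Nat.prime_dvd_prime_iff_eq Nat.prime_three hp, eq_comm]

/-- Multiplication of Euler factors by `1 - χ₃(p) x`. It takes `1 + x - 2x²` to `1 - 3x² + 2x³` for
`p ≡ 1`, takes `1 - x` to `1 - x²` for `p ≡ 2`, and fixes `1 - x + 2x² - 2x³` at `p = 3`. -/
theorem charThree_mul_quotient :
    charThree * ofPrimePowers quotientCoeff = ofPrimePowers zetaQuotientCoeff := by
  refine mul_eq_of_prime_pow_recurrence isMultiplicative_charThree
    (isMultiplicative_ofPrimePowers _) (isMultiplicative_ofPrimePowers _)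
    (fun p k _ => charThree_pow p k) fun p k hp => ?_
  rw [ofPrimePowers_prime_pow_of_zero hp rfl, ofPrimePowers_prime_pow_of_zero hp rfl,
    ofPrimePowers_prime_pow_of_zero hp rfl, charThree_apply]
  have h3 : p % 3 < 3 := Nat.mod_lt _ (by norm_num)
  rcases k with _ | _ | _ | _ | k <;> simp only [quotientCoeff, zetaQuotientCoeff] <;>
    interval_cases p % 3 <;> norm_num

theorem zeta_mul_zetaQuotient :
    (ArithmeticFunction.zeta : ArithmeticFunction ℝ) * ofPrimePowers zetaQuotientCoeff =
      ofPrimePowers fun p k => if k = 0 then 1 else (localCount p k : ℝ) := by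
  refine mul_eq_of_prime_pow_recurrence ArithmeticFunction.isMultiplicative_zeta.natCast
    (isMultiplicative_ofPrimePowers _) (isMultiplicative_ofPrimePowers _)
    (fun p k hp => ?_) fun p k hp => ?_
  · simp [ArithmeticFunction.natCoe_apply, ArithmeticFunction.zeta_apply, hp.ne_zero]
  · rw [ofPrimePowers_prime_pow_of_zero hp (if_pos rfl),
      ofPrimePowers_prime_pow_of_zero hp (if_pos rfl), ofPrimePowers_prime_pow_of_zero hp rfl,
      ArithmeticFunction.natCoe_apply,
      ArithmeticFunction.zeta_apply_ne hp.ne_zero]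
    simp only [localCount, ← prime_mod_three_eq_zero_iff hp]
    have h3 : p % 3 < 3 := Nat.mod_lt _ (by norm_num)
    rcases k with _ | _ | _ | _ | k <;> simp only [zetaQuotientCoeff] <;>
      interval_cases p % 3 <;> (norm_num; try grind)

theorem ofPrimePowers_localCount (n : ℕ) (hn : n ≠ 0) :
    ofPrimePowers (fun p k => if k = 0 then 1 else (localCount p k : ℝ)) n = sexticCount n := by
  rw [ofPrimePowers_apply _ hn, sexticCount, Nat.cast_prod]
  refine Finset.prod_congr rfl fun p hp => if_neg ?_
  exact ((Nat.prime_of_mem_primeFactors hp).factorization_pos_of_dvd hn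
    (Nat.dvd_of_mem_primeFactors hp)).ne'

theorem quotient_mul_zetaCharThree :
    ofPrimePowers quotientCoeff * zetaCharThree =
      ofPrimePowers fun p k => if k = 0 then 1 else (localCount p k : ℝ) := by
  rw [zetaCharThree, ← mul_assoc, mul_comm _ charThree, charThree_mul_quotient, mul_comm,
    zeta_mul_zetaQuotient]

/-- `quotientCoeff` weighted by `1 / n`. -/
noncomputable def weightedQuotient (n : ℕ) : ℝ := ofPrimePowers quotientCoeff n * (n : ℝ)⁻¹

theorem weightedQuotient_zero : weightedQuotient 0 = 0 := by simp [weightedQuotient]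

theorem weightedQuotient_one : weightedQuotient 1 = 1 := by
  simp [weightedQuotient, (isMultiplicative_ofPrimePowers quotientCoeff).map_one]

theorem weightedQuotient_mul {m n : ℕ} (h : m.Coprime n) :
    weightedQuotient (m * n) = weightedQuotient m * weightedQuotient n := by
  rw [weightedQuotient, (isMultiplicative_ofPrimePowers quotientCoeff).map_mul_of_coprime h]
  simp only [weightedQuotient]
  push_cast
  rw [mul_inv]
  ring

theorem weightedQuotient_prime_pow {p : ℕ} (hp : p.Prime) (k : ℕ) :
    weightedQuotient (p ^ k) = quotientCoeff p k * ((p : ℝ)⁻¹) ^ k := by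
  rw [weightedQuotient, ofPrimePowers_prime_pow_of_zero hp rfl]
  push_cast
  rw [inv_pow]

theorem weightedQuotient_prime_pow_eq_zero {p : ℕ} (hp : p.Prime) {k : ℕ}
    (hk : k ∉ Finset.range 4) : weightedQuotient (p ^ k) = 0 := by
  obtain ⟨j, rfl⟩ : ∃ j, k = j + 4 := ⟨k - 4, by rw [Finset.mem_range] at hk; omega⟩
  rw [weightedQuotient_prime_pow hp]
  simp [quotientCoeff]

theorem tsum_weightedQuotient {p : ℕ} (hp : p.Prime) :
    ∑' k : ℕ, weightedQuotient (p ^ k) =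
      ∑ k ∈ Finset.range 4, quotientCoeff p k * ((p : ℝ)⁻¹) ^ k := by
  rw [tsum_eq_sum fun k hk => weightedQuotient_prime_pow_eq_zero hp hk]
  exact Finset.sum_congr rfl fun k _ => weightedQuotient_prime_pow hp k

theorem tsum_norm_weightedQuotient {p : ℕ} (hp : p.Prime) :
    ∑' k : ℕ, ‖weightedQuotient (p ^ k)‖ =
      ∑ k ∈ Finset.range 4, |quotientCoeff p k| * ((p : ℝ)⁻¹) ^ k := by
  rw [tsum_eq_sum (s := Finset.range 4) fun k hk => by
    rw [weightedQuotient_prime_pow_eq_zero hp hk, norm_zero]]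
  refine Finset.sum_congr rfl fun k _ => ?_
  rw [weightedQuotient_prime_pow hp, norm_mul, Real.norm_eq_abs,
    Real.norm_of_nonneg (by positivity)]

/-- The constant `6` is dictated by `p = 3`, the only prime with a linear term: there the absolute
values add up to `1 + 17/27`, against `1 + 18/27`. For positivity, the factor at `p ≡ 1` is `(1 +
2z)(1 - z)²` with `z = 1 / p`. -/
theorem local_bounds {p : ℕ} (hp : p.Prime) :
    ∑ k ∈ Finset.range 4, |quotientCoeff p k| * ((p : ℝ)⁻¹) ^ k ≤ 1 + 6 / (p : ℝ) ^ 2 ∧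
    |∑ k ∈ Finset.range 4, quotientCoeff p k * ((p : ℝ)⁻¹) ^ k - 1| ≤ 6 / (p : ℝ) ^ 2 ∧
    0 < ∑ k ∈ Finset.range 4, quotientCoeff p k * ((p : ℝ)⁻¹) ^ k := by
  have h2 : (2 : ℝ) ≤ p := by exact_mod_cast hp.two_le
  have hz0 : 0 < (p : ℝ)⁻¹ := by positivity
  have hz1 : (p : ℝ)⁻¹ ≤ 1 / 2 := by
    rw [one_div]
    exact inv_anti₀ (by norm_num) h2
  have h6 : 6 / (p : ℝ) ^ 2 = 6 * ((p : ℝ)⁻¹) ^ 2 := by rw [inv_pow, div_eq_mul_inv]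
  rw [h6]
  have h3 : p % 3 < 3 := Nat.mod_lt _ (by norm_num)
  have hcases : p % 3 = 0 ∨ p % 3 = 1 ∨ p % 3 = 2 := by omega
  rcases hcases with h | h | h
  · have hp3 := (prime_mod_three_eq_zero_iff hp).1 h
    subst hp3
    simp only [Finset.sum_range_succ, Finset.sum_range_zero, quotientCoeff]
    norm_num [abs_le]
  · simp only [Finset.sum_range_succ, Finset.sum_range_zero, quotientCoeff, h]
    have hz : (p : ℝ)⁻¹ ^ 3 = (p : ℝ)⁻¹ * (p : ℝ)⁻¹ ^ 2 := by ring
    have hz2 : 0 < (p : ℝ)⁻¹ ^ 2 := by positivity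
    set z := (p : ℝ)⁻¹
    norm_num
    refine ⟨?_, abs_le.2 ⟨?_, ?_⟩, ?_⟩ <;> nlinarith
  · simp only [Finset.sum_range_succ, Finset.sum_range_zero, quotientCoeff, h]
    have hz2 : 0 < (p : ℝ)⁻¹ ^ 2 := by positivity
    set z := (p : ℝ)⁻¹
    norm_num
    refine ⟨by nlinarith, ?_⟩
    rw [abs_of_pos hz0]
    linarith

theorem summable_norm_weightedQuotient : Summable fun n => ‖weightedQuotient n‖ := by
  refine summable_norm_of_prime_pow (C := 6) weightedQuotient_zero weightedQuotient_one
    weightedQuotient_mul (fun hp => ?_) (fun hp => ?_) (by norm_num)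
  · refine summable_of_ne_finset_zero (s := Finset.range 4) fun k hk => ?_
    rw [weightedQuotient_prime_pow_eq_zero hp hk, norm_zero]
  · rw [tsum_norm_weightedQuotient hp]
    exact (local_bounds hp).1

theorem tsum_weightedQuotient_pos : 0 < ∑' n, weightedQuotient n := by
  refine tsum_pos_of_prime_pow (C := 6) weightedQuotient_zero weightedQuotient_one
    weightedQuotient_mul summable_norm_weightedQuotient (fun hp => ?_) (fun hp => ?_)
  · rw [tsum_weightedQuotient hp]
    exact (local_bounds hp).2.1
  · rw [tsum_weightedQuotient hp]
    exact (local_bounds hp).2.2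

/-- The constant is `L(1, χ₃)` times the value at `1` of the quotient series, a positive Euler
product. -/
theorem exists_tendsto_sum_sexticCount_div : ∃ K : ℝ, 0 < K ∧
    Tendsto (fun N : ℕ => (∑ n ∈ Finset.Ioc 0 N, (sexticCount n : ℝ)) / N) atTop (𝓝 K) := by
  obtain ⟨L, hL0, hL⟩ := exists_tendsto_sum_zetaCharThree_div
  refine ⟨_, ?_, (tendsto_sum_mul_div (h := ofPrimePowers quotientCoeff)
    summable_norm_weightedQuotient abs_sum_zetaCharThree_le hL).congr fun N => ?_⟩
  · rw [tsum_mul_right]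
    exact mul_pos tsum_weightedQuotient_pos hL0
  · rw [quotient_mul_zetaCharThree]
    congr 1
    exact Finset.sum_congr rfl fun n hn =>
      ofPrimePowers_localCount n (Finset.mem_Ioc.1 hn).1.ne'

theorem countUpTo_totalChars {X : ℝ} (hX : 1 ≤ X) :
    (countUpTo (totalChars 6) X : ℝ) =
      (∑ n ∈ Finset.Ioc 0 ⌊X⌋₊, (sexticCount n : ℝ)) - 1 := by
  rw [countUpTo_eq_sum (N := fun q => if q = 1 then 0 else sexticCount q)
    (fun χ h => h.1.1) ncard_totalChars (by linarith)]
  have h1 : 1 ∈ Finset.Ioc 0 ⌊X⌋₊ := Finset.mem_Ioc.2 ⟨one_pos, Nat.one_le_floor_iff X |>.2 hX⟩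
  rw [← Finset.add_sum_erase _ _ h1, show Finset.Icc 1 ⌊X⌋₊ = Finset.Ioc 0 ⌊X⌋₊ from rfl,
    ← Finset.add_sum_erase _ _ h1, if_pos rfl, zero_add]
  have h2 : sexticCount 1 = 1 := by simp [sexticCount]
  rw [h2]
  push_cast
  rw [add_sub_cancel_left]
  refine Finset.sum_congr rfl fun n hn => ?_
  rw [if_neg (Finset.ne_of_mem_erase hn)]

theorem countUpTo_primeConductorChars {X : ℝ} (hX : 0 ≤ X) :
    countUpTo (primeConductorChars 6) X = 2 * (primesInClass (1 : ZMod 6) X).card := by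
  rw [countUpTo_eq_sum (N := fun q => if q.Prime ∧ (q : ZMod 6) = 1 then 2 else 0)
    (fun χ h => h.1.1) ncard_primeConductorChars hX, ← Finset.sum_filter, Finset.sum_const,
    smul_eq_mul, mul_comm]
  rfl

end SexticMeanValue

end SexticCount

/-! ### The two asymptotics -/

theorem mainTheorem5 :
    (∃ K : ℝ, 0 < K ∧
      (fun X : ℝ => (SexticCount.countUpTo (SexticCount.totalChars 6) X : ℝ))
        ~[atTop] fun X : ℝ => K * X) ∧
    (fun X : ℝ => (SexticCount.countUpTo (SexticCount.primeConductorChars 6) X : ℝ))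
      ~[atTop] fun X : ℝ => X / Real.log X := by
  constructor
  · obtain ⟨K, hK, hlim⟩ := SexticCount.exists_tendsto_sum_sexticCount_div
    refine ⟨K, hK, (isEquivalent_iff_tendsto_one ?_).2 ?_⟩
    · filter_upwards [eventually_gt_atTop 0] with X hX
      positivity
    · have h1 := ((hlim.comp tendsto_nat_floor_atTop).mul
        (tendsto_nat_floor_div_atTop (R := ℝ))).sub (tendsto_inv_atTop_zero (𝕜 := ℝ))
      have h2 := h1.div_const K
      rw [mul_one, sub_zero, div_self hK.ne'] at h2
      refine h2.congr' ?_
      filter_upwards [eventually_ge_atTop 1] with X hX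
      have hX0 : 0 < X := by linarith
      have hf : (0 : ℝ) < ⌊X⌋₊ := by exact_mod_cast Nat.floor_pos.2 hX
      simp only [Pi.div_apply, Function.comp_apply]
      rw [SexticCount.countUpTo_totalChars hX]
      field_simp
  · refine (isEquivalent_iff_tendsto_one ?_).2 ?_
    · filter_upwards [eventually_gt_atTop 1] with X hX
      have := Real.log_pos hX
      positivity
    · have h1 := (SexticCount.tendsto_card_primesInClass_mul_log_div
        (isUnit_one : IsUnit (1 : ZMod 6))).const_mul 2
      have h6 : Nat.totient 6 = 2 := rfl
      rw [h6, Nat.cast_ofNat, mul_inv_cancel₀ (two_ne_zero)] at h1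
      refine h1.congr' ?_
      filter_upwards [eventually_gt_atTop 1] with X hX
      have := Real.log_pos hX
      simp only [Pi.div_apply]
      rw [SexticCount.countUpTo_primeConductorChars (by linarith)]
      push_cast
      field_simp
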